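/- Let $\Bbbk$ be a field and $S=\Bbbk[x_1,\dots,x_n]$. Let $I\subset S$ be a Borel fixed ideal, i.e. a monomial ideal such that $\mathsf m\in I$ a monomial, $x_i\mid \mathsf m$ and $j<i$ imply $(x_j/x_i)\,\mathsf m\in I$. Let $G(I)$ be its set of minimal monomial generators, and let $d\ge 1$ be an integer with $\deg \mathsf m\le d$ for all $\mathsf m\in G(I)$. Let $0=a_0\le a_1\le a_2\le\cdots$ be a non-decreasing sequence of integers, let $N\ge n+a_{d-1}$, and put $$\widetilde S=\Bbbk[x_{i,j}\mid 1\le i\le n,\ 1\le j\le d],\qquad T=\Bbbk[x_1,\dots,x_N].$$ For a monomial $\mathsf m=x_{\alpha_1}x_{\alpha_2}\cdots x_{\alpha_e}\in S$ with $\alpha_1\le\cdots\le\alpha_e$ and $e\le d$ put $$\operatorname{BoX}(\mathsf m)=\prod_{i=1}^e x_{\alpha_i,i}\in\widetilde S,\qquad \mathsf m^{\sigma(a)}=\prod_{i=1}^e x_{\alpha_i+a_{i-1}}\in T,$$ and let $\operatorname{BoX}(I)=(\operatorname{BoX}(\mathsf m)\mid \mathsf m\in G(I))\subset \widetilde S$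 and $I^{\sigma(a)}=(\mathsf m^{\sigma(a)}\mid \mathsf m\in G(I))\subset T$. Let $\psi:\widetilde S\to T$ be the $\Bbbk$-algebra homomorphism with $\psi(x_{i,j})=x_{i+a_{j-1}}$, and let $X_a=\{x_{i,j}-x_{i',j'}\mid i+a_{j-1}=i'+a_{j'-1}\}\subset\widetilde S$. A pretty clean filtration of a module $M$ over a commutative ring $R$ is a chain of submodules $0=M_0\subseteq M_1\subseteq\cdots\subseteq M_t=M$ with $M_i/M_{i-1}\cong R/\mathfrak p_i$ for prime ideals $\mathfrak p_1,\dots,\mathfrak p_t$ such that $i<j$ and $\mathfrak p_i\subseteq\mathfrak p_j$ imply $\mathfrak p_i=\mathfrak p_j$. Then the following hold. 1. $T/I^{\sigma(a)}$ has a pretty clean filtration. More precisely, $\widetilde S/\operatorname{BoX}(I)$ has a pretty clean filtration $F_0\subseteq\cdots\subseteq F_t$ whose base change along $\psi$ is a pretty clean filtration of $T/I^{\sigma(a)}$: the map $b\otimes\bar r\mapsto\overline{b\,\psi(r)}$ is an isomorphism $T\otimes_{\widetilde S}\widetilde S/\operatorname{BoX}(I)\cong T/I^{\sigma(a)}$,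 the maps $T\otimes_{\widetilde S}F_i\to T\otimes_{\widetilde S}\widetilde S/\operatorname{BoX}(I)$ are injective, and their images form a pretty clean filtration of $T/I^{\sigma(a)}$. Here $\ker\psi=(\Theta_a)$ for every subset $\Theta_a\subseteq X_a$ that is a basis of the $\Bbbk$-linear span of $X_a$. 2. If $a_{i+1}>a_i$ for all $i$, then $I^{\sigma(a)}$ is a squarefree monomial ideal. 3. If $I^{\sigma(a)}$ is a squarefree monomial ideal, then the simplicial complex $\{F\subseteq\{1,\dots,N\}\mid \prod_{i\in F}x_i\notin I^{\sigma(a)}\}$ is non-pure shellable in the sense of Björner and Wachs: its facets can be ordered as $F_1,\dots,F_t$ such that for each $2\le l\le t$ all maximal faces of $(\langle F_1\rangle\cup\cdots\cup\langle F_{l-1}\rangle)\cap\langle F_l\rangle$ have exactly $|F_l|-1$ elements, where $\langle F\rangle$ is the set of all subsets of $F$. -/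

import Mathlib

open MvPolynomial
open scoped TensorProduct

noncomputable section

namespace BoxPol

/-! ### Monomial ideals and Borel fixed ideals

A monomial is given by its exponent vector, and `x_1, …, x_n` are indexed by `Fin n`
(so the index `i` of the mathematics is `i + 1` here, and likewise for all other indices). -/

section Ideals

variable {k : Type*} [Field k] {V : Type*}

/-- The set `G(I)` of (exponent vectors of) minimal monomial generators: the monomials in `I`
that are minimal with respect to divisibility. -/
def minGens (I : Ideal (MvPolynomial V k)) : Set (V →₀ ℕ) :=
  {m | Minimal (fun m' : V →₀ ℕ => monomial m' (1 : k) ∈ I) m}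

/-- A monomial ideal: an ideal generated by monomials. -/
def IsMonomialIdeal (I : Ideal (MvPolynomial V k)) : Prop :=
  ∃ A : Set (V →₀ ℕ), I = Ideal.span ((fun m => monomial m (1 : k)) '' A)

/-- A squarefree monomial ideal: an ideal generated by squarefree monomials `∏_{v ∈ F} x_v`. -/
def IsSquarefreeMonomialIdeal (I : Ideal (MvPolynomial V k)) : Prop :=
  ∃ A : Set (Finset V),
    I = Ideal.span ((fun F => ∏ v ∈ F, (X v : MvPolynomial V k)) '' A)

/-- A monomial ideal `I` is Borel fixed if `m ∈ I`, `x_i ∣ m` and `j < i` imply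
`(x_j / x_i) m ∈ I` for monomials `m`. -/
def IsBorelFixed {n : ℕ} (I : Ideal (MvPolynomial (Fin n) k)) : Prop :=
  IsMonomialIdeal I ∧
    ∀ m : Fin n →₀ ℕ, monomial m (1 : k) ∈ I → ∀ i j : Fin n, m i ≠ 0 → j < i →
      monomial (m - Finsupp.single i 1 + Finsupp.single j 1) (1 : k) ∈ I

end Ideals

/-! ### The operations `BoX` and `σ(a)` -/

/-- The sequence `α_1 ≤ α_2 ≤ ⋯ ≤ α_e` with `m = x_{α_1} x_{α_2} ⋯ x_{α_e}`. -/
def alphaSeq {n : ℕ} (m : Fin n →₀ ℕ) : List (Fin n) :=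
  (Finsupp.toMultiset m).sort (· ≤ ·)

section Operations

variable (k : Type*) [Field k]

/-- `BoX(m) = ∏_i x_{α_i, i}`, in the polynomial ring on `x_{i,j}`, `1 ≤ i ≤ n`, `1 ≤ j ≤ d`.
It is meaningful for `deg m ≤ d` (factors without a variable are left out). -/
def boxMonomial {n : ℕ} (d : ℕ) (m : Fin n →₀ ℕ) : MvPolynomial (Fin n × Fin d) k :=
  ∏ p : Fin (alphaSeq m).length,
    if h : p.val < d then X ((alphaSeq m).get p, ⟨p.val, h⟩) else 1

/-- The variable of `k[x_1, …, x_N]` with (zero-based) index `s < N`; the value for `s ≥ N` is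
a dummy. -/
def varT (N s : ℕ) : MvPolynomial (Fin N) k :=
  if h : s < N then X ⟨s, h⟩ else 1

/-- `m^{σ(a)} = ∏_i x_{α_i + a_{i-1}}` (the position `p` is `i - 1`). -/
def sigmaMonomial {n : ℕ} (N : ℕ) (a : ℕ → ℕ) (m : Fin n →₀ ℕ) : MvPolynomial (Fin N) k :=
  ∏ p : Fin (alphaSeq m).length, varT k N (((alphaSeq m).get p).val + a p.val)

/-- The ring homomorphism `ψ`, `x_{i,j} ↦ x_{i + a_{j-1}}`. -/
def psi (n d N : ℕ) (a : ℕ → ℕ) :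
    MvPolynomial (Fin n × Fin d) k →ₐ[k] MvPolynomial (Fin N) k :=
  aeval fun q => varT k N (q.1.val + a q.2.val)

/-- The set `X_a` of all `x_{i,j} - x_{i',j'}` with `i + a_{j-1} = i' + a_{j'-1}`. -/
def linForms (n d : ℕ) (a : ℕ → ℕ) : Set (MvPolynomial (Fin n × Fin d) k) :=
  {f | ∃ q q' : Fin n × Fin d,
    q.1.val + a q.2.val = q'.1.val + a q'.2.val ∧ f = X q - X q'}

variable {k}

/-- `BoX(I) = (BoX(m) ∣ m ∈ G(I))`. -/
def boxIdeal {n : ℕ} (d : ℕ) (I : Ideal (MvPolynomial (Fin n) k)) :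
    Ideal (MvPolynomial (Fin n × Fin d) k) :=
  Ideal.span (boxMonomial k d '' minGens I)

/-- `I^{σ(a)} = (m^{σ(a)} ∣ m ∈ G(I))`. -/
def sigmaIdeal {n : ℕ} (N : ℕ) (a : ℕ → ℕ) (I : Ideal (MvPolynomial (Fin n) k)) :
    Ideal (MvPolynomial (Fin N) k) :=
  Ideal.span (sigmaMonomial k N a '' minGens I)

end Operations

/-! ### Pretty clean filtrations -/

/-- `0 = F_0 ⊆ F_1 ⊆ ⋯ ⊆ F_t = M` is a pretty clean filtration with primes `P_i`:
`F_i / F_{i-1} ≅ R / P_i`, and `P_i ⊆ P_j` with `i < j` only if `P_i = P_j`. -/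
structure IsPrettyCleanFiltration {R M : Type*} [CommRing R] [AddCommGroup M] [Module R M]
    {t : ℕ} (F : Fin (t + 1) → Submodule R M) (P : Fin t → Ideal R) : Prop where
  bot : F 0 = ⊥
  top : F (Fin.last t) = ⊤
  le_succ : ∀ i : Fin t, F i.castSucc ≤ F i.succ
  prime : ∀ i : Fin t, (P i).IsPrime
  quotient : ∀ i : Fin t,
    Nonempty ((F i.succ ⧸ (F i.castSucc).submoduleOf (F i.succ)) ≃ₗ[R] R ⧸ P i)
  pretty : ∀ i j : Fin t, i < j → P i ≤ P j → P i = P j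

/-- The chain `G` of submodules of `B / K` is the base change along `f : A → B` of the chain `F`
of submodules of `A / J`: the canonical map `b ⊗ [r] ↦ [b f(r)]` is an isomorphism
`B ⊗_A (A / J) ≅ B / K`, each `B ⊗_A F_i → B ⊗_A (A / J)` is injective, and `G_i` is the
submodule which corresponds to `B ⊗_A F_i`. -/
def IsBaseChangeChain {A B : Type*} [CommRing A] [CommRing B] (f : A →+* B)
    {J : Ideal A} {K : Ideal B} {t : ℕ}
    (F : Fin (t + 1) → Submodule A (A ⧸ J)) (G : Fin (t + 1) → Submodule B (B ⧸ K)) : Prop :=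
  letI : Algebra A B := f.toAlgebra
  ∃ e : (B ⊗[A] (A ⧸ J)) ≃ₗ[B] (B ⧸ K),
    (∀ (b : B) (r : A),
      e (b ⊗ₜ[A] Ideal.Quotient.mk J r) = Ideal.Quotient.mk K (b * f r)) ∧
    ∀ i, Function.Injective ((F i).subtype.lTensor B) ∧
      G i = ((F i).baseChange B).map (e : (B ⊗[A] (A ⧸ J)) →ₗ[B] (B ⧸ K))

/-! ### Simplicial complexes

A simplicial complex on the finite vertex set `V` is a lower set in `Finset V`; the empty face is
allowed, and so are the complexes `{∅}` and `∅`. -/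

/-- The simplicial complex of a squarefree monomial ideal `I`: its faces are the `F ⊆ V` with
`∏_{v ∈ F} x_v ∉ I`. -/
def stanleyReisner {k : Type*} [Field k] {V : Type*} (I : Ideal (MvPolynomial V k)) :
    LowerSet (Finset V) where
  carrier := {F | ∏ v ∈ F, (X v : MvPolynomial V k) ∉ I}
  lower' := fun _ _ h hF hG => hF (Ideal.mem_of_dvd I (Finset.prod_dvd_prod_of_subset _ _ _ h) hG)

/-- Non-pure shellability (Björner–Wachs): the facets can be listed as `F_1, …, F_t` so that, for
each `k ≥ 2`, the complex `(⟨F_1⟩ ∪ ⋯ ∪ ⟨F_{k-1}⟩) ∩ ⟨F_k⟩` is pure of dimension `dim F_k - 1`,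
that is, all its maximal faces have `|F_k| - 1` elements. -/
def IsNonpureShellable {V : Type*} (Δ : LowerSet (Finset V)) : Prop :=
  ∃ (t : ℕ) (F : Fin t → Finset V), Function.Injective F ∧
    Set.range F = {H | Maximal (· ∈ Δ) H} ∧
    ∀ (l : Fin t) (H : Finset V),
      Maximal (fun H' => (∃ i < l, H' ⊆ F i) ∧ H' ⊆ F l) H → H.card + 1 = (F l).card

end BoxPol

end

open BoxPol

open BoxPol

noncomputable section

namespace BoxPol

/-! ### Monomial ideals whose successive colon ideals are generated by variables. -/

section Datum

variable {k : Type*} [Field k] {W : Type*}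

/-! A monomial of degree at most `d` is encoded as a non-decreasing sequence `v : Fin d → ℕ` with
values in `0, …, n`, where the value `n` stands for "no letter". Borel fixedness makes the sequences
of monomials in `I` a lower set `L` for the componentwise order, and the monomials `∏ f(v_l, l)`, `v
∈ L`, generate BoX(I) for `f = id` and the σ(a)-ideal for `f = shiftMap`. Both maps satisfy
`IsShiftMap`, so one argument treats both rings.

A head is a sequence outside `L` that enters `L` once its maximum `c` is lowered (or has `c = 0`);
its monomial keeps only the letters below `c`. The monomials of the heads are added to the ideal by
decreasing `c`, then by increasing sum. Each colon ideal is then generated by exactly `c` variables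
(`heads_step`, `le_of_seqExp_le`, `card_insertSet`). The factors of the resulting filtration are
therefore cyclic with prime annihilator, and as the number of variables never grows, an inclusion of
an earlier prime in a later one is an equality.

Heads do not depend on `f`, and the primes over `T` are the extensions of those over the box ring.
This yields the base change by induction along the filtration (`lTensor_chainSubmodule_injective`).
In the squarefree case the complements of the sets of variables, in reverse order, form a shelling
in which the supports of the added monomials are the restriction sets
(`IsVarColonSeq.isNonpureShellable`). -/

/-- The ideal generated by the monomials with exponent vectors in `s`. -/
abbrev monoIdeal (k : Type*) [Field k] {W : Type*} (s : Set (W →₀ ℕ)) : Ideal (MvPolynomial W k) :=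
  Ideal.span ((fun m => monomial m (1 : k)) '' s)

/-- The ideal generated by the variables in `A`. -/
abbrev varIdeal (k : Type*) [Field k] {W : Type*} (A : Finset W) : Ideal (MvPolynomial W k) :=
  Ideal.span ((X : W → MvPolynomial W k) '' A)

theorem monomial_mem_monoIdeal {s : Set (W →₀ ℕ)} {m : W →₀ ℕ} :
    monomial m (1 : k) ∈ monoIdeal k s ↔ ∃ g ∈ s, g ≤ m := by
  classical
  rw [mem_ideal_span_monomial_image, support_monomial, if_neg one_ne_zero]
  simp

/-- It is the kernel of the substitution that kills the variables in `A`, an endomorphism of a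
domain. -/
theorem varIdeal_isPrime (A : Finset W) : (varIdeal k A).IsPrime := by
  classical
  let φ : MvPolynomial W k →ₐ[k] MvPolynomial W k := aeval fun w => if w ∈ A then 0 else X w
  have hker : varIdeal k A = RingHom.ker φ := by
    apply le_antisymm
    · rw [Ideal.span_le]
      rintro _ ⟨w, hw, rfl⟩
      simp only [SetLike.mem_coe, RingHom.mem_ker]
      simp [φ, Finset.mem_coe.1 hw]
    · have key : ∀ p : MvPolynomial W k, p - φ p ∈ varIdeal k A := by
        intro p
        induction p using MvPolynomial.induction_on with
        | C a => simp [φ]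
        | add p q hp hq =>
          have : p + q - φ (p + q) = (p - φ p) + (q - φ q) := by rw [map_add]; ring
          rw [this]; exact Ideal.add_mem _ hp hq
        | mul_X p w hp =>
          have : p * X w - φ (p * X w) = (p - φ p) * X w + φ p * (X w - φ (X w)) := by
            rw [map_mul]; ring
          rw [this]
          refine Ideal.add_mem _ (Ideal.mul_mem_right _ _ hp) (Ideal.mul_mem_left _ _ ?_)
          by_cases hw : w ∈ A
          · simp only [φ, aeval_X, if_pos hw, sub_zero]
            exact Ideal.subset_span ⟨w, hw, rfl⟩
          · simp [φ, hw]
      intro p hp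
      have h := key p
      rwa [(RingHom.mem_ker).1 hp, sub_zero] at h
  rw [hker]
  exact RingHom.ker_isPrime _

theorem X_mem_varIdeal {A : Finset W} {w : W} : (X w : MvPolynomial W k) ∈ varIdeal k A ↔ w ∈ A := by
  classical
  rw [mem_ideal_span_X_image]
  constructor
  · intro h
    obtain ⟨i, hi, h1⟩ := h (Finsupp.single w 1) (by simp [X])
    by_cases hiw : w = i
    · exact hiw ▸ hi
    · simp [hiw] at h1
  · exact fun h => mem_ideal_span_X_image.1 (Ideal.subset_span ⟨w, h, rfl⟩)

theorem varIdeal_le {A B : Finset W} : varIdeal k A ≤ varIdeal k B ↔ A ⊆ B := by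
  constructor
  · exact fun h w hw => X_mem_varIdeal.1 (h (X_mem_varIdeal.2 hw))
  · exact fun h => Ideal.span_mono (Set.image_mono h)

/-- A list of monomials `u_0, u_1, …` which, added one by one to the monomial ideal generated by
`gens`, has the colon ideals generated by the sets of variables `A_0, A_1, …`. -/
structure IsVarColonSeq (gens : Set (W →₀ ℕ)) {t : ℕ} (u : Fin t → W →₀ ℕ)
    (A : Fin t → Finset W) : Prop where
  step : ∀ i, ∀ b ∈ A i, (∃ g ∈ gens, g ≤ u i + Finsupp.single b 1) ∨
    ∃ h < i, u h ≤ u i + Finsupp.single b 1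
  avoid_gens : ∀ i w, Disjoint w.support (A i) → ∀ g ∈ gens, ¬ g ≤ u i + w
  avoid : ∀ i w, Disjoint w.support (A i) → ∀ h < i, ¬ u h ≤ u i + w
  top : 0 ∈ gens ∨ ∃ i, u i = 0
  card : Antitone fun i => (A i).card

/-- The exponent vectors in `gens` together with the `u h`, `h < i`. -/
def partialSet (gens : Set (W →₀ ℕ)) {t : ℕ} (u : Fin t → W →₀ ℕ) (i : ℕ) : Set (W →₀ ℕ) :=
  gens ∪ {m | ∃ h : Fin t, h.val < i ∧ m = u h}

variable {gens : Set (W →₀ ℕ)} {t : ℕ} {u : Fin t → W →₀ ℕ} {A : Fin t → Finset W}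

/-- Membership in a monomial ideal is tested term by term: `avoid_gens` and `avoid` exclude every
term free of `A i`, and `step` supplies the variables. -/
theorem IsVarColonSeq.colon (H : IsVarColonSeq gens u A) (i : Fin t) (r : MvPolynomial W k) :
    r * monomial (u i) 1 ∈ monoIdeal k (partialSet gens u i) ↔ r ∈ varIdeal k (A i) := by
  classical
  constructor
  · intro h
    rw [mem_ideal_span_X_image]
    intro m hm
    by_contra hcon
    push Not at hcon
    have hdis : Disjoint m.support (A i) := by
      rw [Finset.disjoint_left]
      exact fun b hb hbA => (Finsupp.mem_support_iff.1 hb) (hcon b hbA)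
    rw [mem_ideal_span_monomial_image] at h
    obtain ⟨g, hg, hle⟩ := h (m + u i) (by
      rw [mem_support_iff, coeff_mul_monomial, mul_one]
      exact mem_support_iff.1 hm)
    rw [add_comm] at hle
    rcases hg with hg | ⟨h, hh, rfl⟩
    · exact H.avoid_gens i m hdis g hg hle
    · exact H.avoid i m hdis h hh hle
  · intro h
    induction h using Submodule.span_induction with
    | mem x hx =>
      obtain ⟨b, hb, rfl⟩ := hx
      have : (X b : MvPolynomial W k) * monomial (u i) 1 =
          monomial (u i + Finsupp.single b 1) 1 := by
        rw [X, monomial_mul, one_mul, add_comm]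
      rw [this, monomial_mem_monoIdeal]
      rcases H.step i b hb with ⟨g, hg, hle⟩ | ⟨h, hh, hle⟩
      · exact ⟨g, Or.inl hg, hle⟩
      · exact ⟨u h, Or.inr ⟨h, hh, rfl⟩, hle⟩
    | zero => simp
    | add x y _ _ hx hy => rw [add_mul]; exact Ideal.add_mem _ hx hy
    | smul c x _ hx => rw [smul_eq_mul, mul_assoc]; exact Ideal.mul_mem_left _ _ hx

end Datum

/-! ### Filtrations of a cyclic module by successively added generators. -/

section Chain

variable {R : Type*} [CommRing R]

/-- The submodule of `R ⧸ K` generated by the classes of the `x h`, `h < i`. -/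
def chainSubmodule (K : Ideal R) {t : ℕ} (x : Fin t → R) (i : ℕ) : Submodule R (R ⧸ K) :=
  Submodule.span R ((fun h => Ideal.Quotient.mk K (x h)) '' {h | h.val < i})

theorem mk_mem_chainSubmodule {K : Ideal R} {t : ℕ} {x : Fin t → R} {i : ℕ} {r : R} :
    Ideal.Quotient.mk K r ∈ chainSubmodule K x i ↔ r ∈ K ⊔ Ideal.span (x '' {h | h.val < i}) := by
  have : chainSubmodule K x i = Submodule.map K.mkQ (Ideal.span (x '' {h | h.val < i})) := by
    rw [chainSubmodule, Ideal.span, Submodule.map_span, Set.image_image]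
    rfl
  rw [this, ← Submodule.comap_map_mkQ]
  rfl

theorem chainSubmodule_zero (K : Ideal R) {t : ℕ} (x : Fin t → R) : chainSubmodule K x 0 = ⊥ := by
  simp [chainSubmodule]

theorem chainSubmodule_mono (K : Ideal R) {t : ℕ} (x : Fin t → R) {i j : ℕ} (h : i ≤ j) :
    chainSubmodule K x i ≤ chainSubmodule K x j :=
  Submodule.span_mono (Set.image_mono fun _ hl => lt_of_lt_of_le hl h)

theorem mk_mem_chainSubmodule_succ (K : Ideal R) {t : ℕ} (x : Fin t → R) (i : Fin t) :
    Ideal.Quotient.mk K (x i) ∈ chainSubmodule K x (i + 1) :=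
  Submodule.subset_span ⟨i, Nat.lt_succ_self _, rfl⟩

theorem chainSubmodule_succ (K : Ideal R) {t : ℕ} (x : Fin t → R) (i : Fin t) :
    chainSubmodule K x (i + 1) =
      chainSubmodule K x i ⊔ Submodule.span R {Ideal.Quotient.mk K (x i)} := by
  have : {h : Fin t | h.val < i.val + 1} = {h : Fin t | h.val < i.val} ∪ {i} := by
    ext h
    simp only [Set.mem_ofPred_eq, Set.union_singleton, Set.mem_insert_iff, Fin.ext_iff]
    omega
  rw [chainSubmodule, this, Set.image_union, Submodule.span_union, Set.image_singleton]
  rfl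

/-- The factor is cyclic, generated by the class of `x i`, and its annihilator is the colon ideal
`P`. -/
theorem chainSubmodule_quotient (K : Ideal R) {t : ℕ} (x : Fin t → R) (i : Fin t) {P : Ideal R}
    (hP : ∀ r, Ideal.Quotient.mk K (r * x i) ∈ chainSubmodule K x i ↔ r ∈ P) :
    Nonempty ((chainSubmodule K x (i + 1) ⧸
      (chainSubmodule K x i).submoduleOf (chainSubmodule K x (i + 1))) ≃ₗ[R] R ⧸ P) := by
  let y : chainSubmodule K x (i + 1) := ⟨_, mk_mem_chainSubmodule_succ K x i⟩
  let N := (chainSubmodule K x i).submoduleOf (chainSubmodule K x (i + 1))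
  let φ : R →ₗ[R] (chainSubmodule K x (i + 1) ⧸ N) := N.mkQ ∘ₗ LinearMap.toSpanSingleton R _ y
  have hker : LinearMap.ker φ = P := by
    ext r
    rw [← hP r, LinearMap.mem_ker]
    simp only [φ, LinearMap.comp_apply, LinearMap.toSpanSingleton_apply, Submodule.mkQ_apply,
      Submodule.Quotient.mk_eq_zero]
    rfl
  have hsurj : Function.Surjective φ := by
    intro z
    obtain ⟨⟨z, hz⟩, rfl⟩ := N.mkQ_surjective z
    have hz' := hz
    rw [chainSubmodule_succ, Submodule.mem_sup] at hz'
    obtain ⟨z₁, h₁, z₂, h₂, rfl⟩ := hz'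
    obtain ⟨r, rfl⟩ := Submodule.mem_span_singleton.1 h₂
    refine ⟨r, ?_⟩
    simp only [φ, LinearMap.comp_apply, LinearMap.toSpanSingleton_apply, Submodule.mkQ_apply]
    rw [eq_comm, Submodule.Quotient.eq]
    change (z₁ + r • Ideal.Quotient.mk K (x i)) - r • Ideal.Quotient.mk K (x i) ∈ chainSubmodule K x i
    simpa using h₁
  exact ⟨(((Submodule.quotEquivOfEq _ _ hker).symm).trans
    (φ.quotKerEquivOfSurjective hsurj)).symm⟩

end Chain

/-! ### The pretty clean filtration of a colon sequence. -/

section DatumChain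

variable {k : Type*} [Field k] {W : Type*} {gens : Set (W →₀ ℕ)} {t : ℕ} {u : Fin t → W →₀ ℕ}
  {A : Fin t → Finset W}

theorem monoIdeal_sup_span (i : ℕ) :
    monoIdeal k gens ⊔ Ideal.span ((fun h => monomial (u h) (1 : k)) '' {h | h.val < i}) =
      monoIdeal k (partialSet gens u i) := by
  rw [monoIdeal, monoIdeal, ← Ideal.span_union, partialSet, Set.image_union]
  congr 2
  ext p
  constructor
  · rintro ⟨h, hh, rfl⟩
    exact ⟨u h, ⟨h, hh, rfl⟩, rfl⟩
  · rintro ⟨_, ⟨h, hh, rfl⟩, rfl⟩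
    exact ⟨h, hh, rfl⟩

theorem IsVarColonSeq.mk_mem_iff (H : IsVarColonSeq gens u A) (i : Fin t) (r : MvPolynomial W k) :
    Ideal.Quotient.mk (monoIdeal k gens) (r * monomial (u i) 1) ∈
      chainSubmodule (monoIdeal k gens) (fun h => monomial (u h) (1 : k)) i ↔
        r ∈ varIdeal k (A i) := by
  rw [mk_mem_chainSubmodule, monoIdeal_sup_span, H.colon]

theorem IsVarColonSeq.isPrettyCleanFiltration (H : IsVarColonSeq gens u A) :
    IsPrettyCleanFiltration (fun i : Fin (t + 1) =>
      chainSubmodule (monoIdeal k gens) (fun h => monomial (u h) (1 : k)) i)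
      (fun i => varIdeal k (A i)) where
  bot := chainSubmodule_zero _ _
  top := by
    rw [eq_top_iff]
    intro z _
    obtain ⟨r, rfl⟩ := Ideal.Quotient.mk_surjective z
    rw [mk_mem_chainSubmodule, monoIdeal_sup_span]
    have : (1 : MvPolynomial W k) ∈ monoIdeal k (partialSet gens u (Fin.last t)) := by
      have h1 : (1 : MvPolynomial W k) = monomial 0 1 := rfl
      rw [h1, monomial_mem_monoIdeal]
      rcases H.top with h | ⟨i, hi⟩
      · exact ⟨0, Or.inl h, le_rfl⟩
      · exact ⟨u i, Or.inr ⟨i, i.2, rfl⟩, hi.le⟩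
    rw [(Ideal.eq_top_iff_one _).2 this]
    trivial
  le_succ i := chainSubmodule_mono _ _ (by simp)
  prime i := varIdeal_isPrime _
  quotient i := chainSubmodule_quotient _ _ i (H.mk_mem_iff i)
  pretty i j hij hle := by
    rw [varIdeal_le] at hle
    rw [Finset.eq_of_subset_of_card_le hle (H.card hij.le)]

end DatumChain

/-! ### Shellability in the squarefree case. -/

section Shelling

variable {k : Type*} [Field k] {W : Type*}

/-- The exponent vector of the squarefree monomial `∏_{w ∈ F} x_w`. -/
def indicatorExp (F : Finset W) : W →₀ ℕ := ∑ w ∈ F, Finsupp.single w 1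

theorem indicatorExp_apply [DecidableEq W] (F : Finset W) (w : W) :
    indicatorExp F w = if w ∈ F then 1 else 0 := by
  rw [indicatorExp, Finsupp.finsetSum_apply]
  simp [Finsupp.single_apply]

theorem indicatorExp_support (F : Finset W) : (indicatorExp F).support = F := by
  classical
  ext w
  simp [indicatorExp_apply]

theorem prod_X_eq_monomial (F : Finset W) :
    ∏ w ∈ F, (X w : MvPolynomial W k) = monomial (indicatorExp F) 1 := by
  rw [indicatorExp, monomial_sum_one]
  rfl

theorem IsSquarefreeMonomialIdeal.monomial_mem {K : Ideal (MvPolynomial W k)}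
    (hK : IsSquarefreeMonomialIdeal K) {m m' : W →₀ ℕ} (hm : monomial m (1 : k) ∈ K)
    (hs : m.support ⊆ m'.support) : monomial m' (1 : k) ∈ K := by
  classical
  obtain ⟨S, rfl⟩ := hK
  have : (fun F : Finset W => ∏ v ∈ F, (X v : MvPolynomial W k)) '' S =
      (fun m => monomial m (1 : k)) '' (indicatorExp '' S) := by
    rw [Set.image_image]
    exact Set.image_congr fun F _ => prod_X_eq_monomial F
  rw [this] at hm ⊢
  rw [monomial_mem_monoIdeal] at hm ⊢
  obtain ⟨_, ⟨F, hF, rfl⟩, hle⟩ := hm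
  refine ⟨_, ⟨F, hF, rfl⟩, fun w => ?_⟩
  rw [indicatorExp_apply]
  split_ifs with hw
  · have h1 := hle w
    rw [indicatorExp_apply, if_pos hw] at h1
    have h2 : w ∈ m'.support := hs (Finsupp.mem_support_iff.2 (by omega))
    have := Finsupp.mem_support_iff.1 h2
    omega
  · exact Nat.zero_le _

variable {gens : Set (W →₀ ℕ)} {t : ℕ} {u : Fin t → W →₀ ℕ} {A : Fin t → Finset W}

/-- A Stanley decomposition: each monomial outside the ideal is `u i` times a monomial free of `A
i`, for the least `i` such that `u i` divides it. -/
theorem IsVarColonSeq.exists_piece (H : IsVarColonSeq gens u A) {m : W →₀ ℕ}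
    (hm : ∀ g ∈ gens, ¬ g ≤ m) :
    ∃ i, u i ≤ m ∧ Disjoint (m - u i).support (A i) ∧ ∀ h, u h ≤ m → i ≤ h := by
  classical
  have hne : (Finset.univ.filter fun i : Fin t => u i ≤ m).Nonempty := by
    rcases H.top with h | ⟨i, hi⟩
    · exact absurd (fun _ => Nat.zero_le _) (hm 0 h)
    · exact ⟨i, by simp [hi]⟩
  let i := (Finset.univ.filter fun i : Fin t => u i ≤ m).min' hne
  have hi : u i ≤ m := (Finset.mem_filter.1 (Finset.min'_mem _ hne)).2
  have hmin : ∀ h, u h ≤ m → i ≤ h := fun h hh =>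
    Finset.min'_le _ h (Finset.mem_filter.2 ⟨Finset.mem_univ _, hh⟩)
  refine ⟨i, hi, ?_, hmin⟩
  rw [Finset.disjoint_left]
  intro b hb hbA
  have hle : u i + Finsupp.single b 1 ≤ m := by
    intro w
    have h1 := hi w
    have h2 := Finsupp.mem_support_iff.1 hb
    rw [Finsupp.tsub_apply] at h2
    rw [Finsupp.add_apply, Finsupp.single_apply]
    split_ifs with hw
    · subst hw; omega
    · omega
  rcases H.step i b hbA with ⟨g, hg, hg'⟩ | ⟨h, hh, hh'⟩
  · exact hm g hg (hg'.trans hle)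
  · exact absurd (hmin h (hh'.trans hle)) (not_le.2 hh)

theorem IsVarColonSeq.exists_piece_support (H : IsVarColonSeq gens u A)
    (hK : IsSquarefreeMonomialIdeal (monoIdeal k gens)) {m : W →₀ ℕ}
    (hm : ∀ g ∈ gens, ¬ g ≤ m) :
    ∃ i, (u i).support ⊆ m.support ∧ Disjoint m.support (A i) ∧
      ∀ h, (u h).support ⊆ m.support → i ≤ h := by
  classical
  -- `M` exceeds all exponents of all `u h`, so `u h` divides the `M`-th power of `m` exactly when
  -- its support lies in that of `m`.
  let M := 1 + ∑ h, (u h).degree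
  have hM : ∀ h w, u h w < M := fun h w => by
    have h1 : u h w ≤ (u h).degree := Finsupp.le_degree w (u h)
    have h2 : (u h).degree ≤ ∑ h, (u h).degree :=
      Finset.single_le_sum (f := fun h => (u h).degree) (fun _ _ => Nat.zero_le _)
        (Finset.mem_univ h)
    simp only [M]; omega
  have hMm : ∀ w, w ∈ m.support → M ≤ (M • m) w := fun w hw => by
    rw [Finsupp.smul_apply, smul_eq_mul]
    exact Nat.le_mul_of_pos_right _ (Nat.pos_of_ne_zero (Finsupp.mem_support_iff.1 hw))
  have hm' : ∀ g ∈ gens, ¬ g ≤ M • m := by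
    by_contra hcon
    push Not at hcon
    have h1 := hK.monomial_mem (monomial_mem_monoIdeal.2 hcon) (m' := m) Finsupp.support_smul
    obtain ⟨g, hg, hle⟩ := monomial_mem_monoIdeal.1 h1
    exact hm g hg hle
  obtain ⟨i, hi, hdis, hmin⟩ := H.exists_piece hm'
  refine ⟨i, (Finsupp.support_mono hi).trans Finsupp.support_smul, ?_,
    fun h hs => hmin h fun w => ?_⟩
  · rw [Finset.disjoint_left] at hdis ⊢
    intro w hw
    refine hdis (Finsupp.mem_support_iff.2 ?_)
    have h1 := hMm w hw
    have h2 := hM i w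
    rw [Finsupp.tsub_apply]
    omega
  · by_cases hw : w ∈ m.support
    · exact (hM h w).le.trans (hMm w hw)
    · rw [Finsupp.notMem_support_iff.1 fun hw' => hw (hs hw')]
      exact Nat.zero_le _

theorem mem_stanleyReisner_iff {F : Finset W} :
    F ∈ stanleyReisner (monoIdeal k gens) ↔ ∀ g ∈ gens, ¬ g ≤ indicatorExp F := by
  change ∏ v ∈ F, (X v : MvPolynomial W k) ∉ monoIdeal k gens ↔ _
  rw [prod_X_eq_monomial, monomial_mem_monoIdeal]
  push Not
  rfl

variable [Fintype W] [DecidableEq W]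

/-- The product of `u i` and all variables outside `A i` avoids the ideal. The piece `j ≤ i`
obtained from its support has `A j ⊆ A i`, and the cardinalities force equality; but `A j` misses
the support of the product. -/
theorem IsVarColonSeq.support_disjoint (H : IsVarColonSeq gens u A)
    (hK : IsSquarefreeMonomialIdeal (monoIdeal k gens)) (i : Fin t) :
    (u i).support ⊆ (A i)ᶜ := by
  let m := u i + indicatorExp (A i)ᶜ
  have hm : ∀ g ∈ gens, ¬ g ≤ m := H.avoid_gens i _ (by
    rw [indicatorExp_support]; exact disjoint_compl_left)
  have hsupp : m.support = (u i).support ∪ (A i)ᶜ := by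
    ext w
    simp only [m, Finsupp.mem_support_iff, Finsupp.add_apply, Finset.mem_union, ne_eq,
      Nat.add_eq_zero_iff, indicatorExp_apply]
    split_ifs with h <;> simp [h]
  obtain ⟨j, -, hdis, hmin⟩ := H.exists_piece_support hK hm
  have hji : j ≤ i := hmin i (by rw [hsupp]; exact Finset.subset_union_left)
  rw [hsupp, Finset.disjoint_union_left] at hdis
  have hAA : A j ⊆ A i := by
    intro b hb
    by_contra hbi
    exact (Finset.disjoint_left.1 hdis.2 (Finset.mem_compl.2 hbi)) hb
  have heq := Finset.eq_of_subset_of_card_le hAA (H.card hji)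
  rw [← heq]
  exact fun w hw => Finset.mem_compl.2 (Finset.disjoint_left.1 hdis.1 hw)

/-- Otherwise `u i` would be a cofactor free of `A h`, and `u i` divides `u h * u i`, against
`avoid`. -/
theorem IsVarColonSeq.not_support_subset (H : IsVarColonSeq gens u A) {i h : Fin t} (hih : i < h) :
    ¬ (u i).support ⊆ (A h)ᶜ := by
  intro hs
  refine H.avoid h (u i) ?_ i hih le_add_self
  rw [Finset.disjoint_left]
  exact fun w hw => Finset.mem_compl.1 (hs hw)

theorem IsVarColonSeq.compl_subset_compl (H : IsVarColonSeq gens u A)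
    (hK : IsSquarefreeMonomialIdeal (monoIdeal k gens)) {i j : Fin t} (hij : (A i)ᶜ ⊆ (A j)ᶜ) :
    i = j := by
  rcases lt_trichotomy i j with h | h | h
  · exact absurd ((H.support_disjoint hK i).trans hij) (H.not_support_subset h)
  · exact h
  · have heq := Finset.eq_of_subset_of_card_le (Finset.compl_subset_compl.1 hij) (H.card h.le)
    have h1 := H.support_disjoint hK j
    rw [heq] at h1
    exact absurd h1 (H.not_support_subset h)

theorem IsVarColonSeq.compl_mem (H : IsVarColonSeq gens u A) (i : Fin t) :
    (A i)ᶜ ∈ stanleyReisner (monoIdeal k gens) := by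
  rw [mem_stanleyReisner_iff]
  intro g hg hle
  refine H.avoid_gens i (indicatorExp (A i)ᶜ) ?_ g hg (hle.trans le_add_self)
  rw [indicatorExp_support]
  exact disjoint_compl_left

theorem IsVarColonSeq.exists_face_subset (H : IsVarColonSeq gens u A)
    (hK : IsSquarefreeMonomialIdeal (monoIdeal k gens)) {F : Finset W}
    (hF : F ∈ stanleyReisner (monoIdeal k gens)) :
    ∃ i, F ⊆ (A i)ᶜ ∧ (u i).support ⊆ F := by
  obtain ⟨i, h1, h2, -⟩ := H.exists_piece_support hK (mem_stanleyReisner_iff.1 hF)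
  rw [indicatorExp_support] at h1 h2
  exact ⟨i, fun w hw => Finset.mem_compl.2 (Finset.disjoint_left.1 h2 hw), h1⟩

/-- A face of the facet `(A i)ᶜ` lies in a facet of larger index exactly if it does not contain the
support of `u i`. Hence the maximal faces of the intersection arise by removing one vertex of that
support. -/
theorem IsVarColonSeq.isNonpureShellable (H : IsVarColonSeq gens u A)
    (hK : IsSquarefreeMonomialIdeal (monoIdeal k gens)) :
    IsNonpureShellable (stanleyReisner (monoIdeal k gens)) := by
  refine ⟨t, fun l => (A l.rev)ᶜ, ?_, ?_, ?_⟩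
  · intro i j hij
    exact Fin.rev_injective (H.compl_subset_compl hK hij.subset)
  · ext F
    constructor
    · rintro ⟨i, rfl⟩
      refine ⟨H.compl_mem _, fun G hG hle => ?_⟩
      obtain ⟨j, hj, -⟩ := H.exists_face_subset hK hG
      have hij := H.compl_subset_compl hK (hle.trans hj)
      change G ⊆ (A i.rev)ᶜ
      rwa [hij]
    · rintro ⟨hF, hmax⟩
      obtain ⟨i, hi, -⟩ := H.exists_face_subset hK hF
      refine ⟨i.rev, ?_⟩
      simp only [Fin.rev_rev]
      exact Finset.Subset.antisymm (hmax (H.compl_mem i) hi) hi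
  · rintro l F ⟨⟨⟨h, hhl, hFh⟩, hFl⟩, hmax⟩
    have hlt : l.rev < h.rev := Fin.rev_lt_rev.2 hhl
    obtain ⟨b, hb, hbh⟩ := Finset.not_subset.1 (H.not_support_subset hlt)
    have hbl : b ∈ (A l.rev)ᶜ := H.support_disjoint hK _ hb
    have hsub : F ⊆ (A l.rev)ᶜ.erase b := fun w hw =>
      Finset.mem_erase.2 ⟨fun hwb => hbh (hwb ▸ hFh hw), hFl hw⟩
    have hface : (A l.rev)ᶜ.erase b ∈ stanleyReisner (monoIdeal k gens) :=
      (stanleyReisner (monoIdeal k gens)).lower (Finset.erase_subset _ _) (H.compl_mem l.rev)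
    obtain ⟨j, hj, hju⟩ := H.exists_face_subset hK hface
    have hlj : l.rev < j := by
      rcases lt_trichotomy j l.rev with hlt' | rfl | hlt'
      · exact absurd (hju.trans (Finset.erase_subset _ _)) (H.not_support_subset hlt')
      · exact absurd rfl (Finset.ne_of_mem_erase (hju hb))
      · exact hlt'
    have hF : F = (A l.rev)ᶜ.erase b := by
      refine Finset.Subset.antisymm hsub (hmax ⟨⟨j.rev, ?_, ?_⟩, Finset.erase_subset _ _⟩ hsub)
      · rw [← Fin.rev_lt_rev, Fin.rev_rev]; exact hlj
      · simpa using hj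
    -- The maximal face is the facet without one vertex `b` of the support.
    rw [hF, Finset.card_erase_of_mem hbl]
    exact Nat.sub_add_cancel (Finset.card_pos.2 ⟨b, hbl⟩)

end Shelling

/-! ### Base change of filtrations. -/

section BaseChange

variable {A B : Type*} [CommRing A] [CommRing B] [Algebra A B]

theorem exists_quotTensorEquiv (J : Ideal A) (K : Ideal B) (hK : K = J.map (algebraMap A B)) :
    ∃ e : (B ⊗[A] (A ⧸ J)) ≃ₗ[B] (B ⧸ K), ∀ (b : B) (r : A),
      e (b ⊗ₜ[A] Ideal.Quotient.mk J r) = Ideal.Quotient.mk K (b * algebraMap A B r) := by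
  subst hK
  refine ⟨(Algebra.TensorProduct.quotIdealMapEquivTensorQuot B J).symm.toLinearEquiv, ?_⟩
  intro b r
  change (Algebra.TensorProduct.quotIdealMapEquivTensorQuot B J).symm _ = _
  have : b ⊗ₜ[A] Ideal.Quotient.mk J r = (r • b) ⊗ₜ[A] (1 : A ⧸ J) := by
    rw [TensorProduct.smul_tmul]
    congr 1
    rw [Algebra.smul_def, mul_one]
    rfl
  rw [this, ← Algebra.TensorProduct.quotIdealMapEquivTensorQuot_mk, AlgEquiv.symm_apply_apply,
    Algebra.smul_def, mul_comm]

theorem isBaseChange_chainSubmodule {J : Ideal A} {K : Ideal B} {t : ℕ} {x : Fin t → A}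
    (e : (B ⊗[A] (A ⧸ J)) ≃ₗ[B] (B ⧸ K))
    (he : ∀ (b : B) (r : A),
      e (b ⊗ₜ[A] Ideal.Quotient.mk J r) = Ideal.Quotient.mk K (b * algebraMap A B r)) (i : ℕ) :
    chainSubmodule K (fun h => algebraMap A B (x h)) i =
      ((chainSubmodule J x i).baseChange B).map (e : (B ⊗[A] (A ⧸ J)) →ₗ[B] (B ⧸ K)) := by
  rw [chainSubmodule, chainSubmodule, Submodule.baseChange_span, Submodule.map_span,
    Set.image_image, Set.image_image]
  congr 1
  refine Set.image_congr fun h _ => ?_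
  change _ = e (1 ⊗ₜ[A] Ideal.Quotient.mk J (x h))
  rw [he, one_mul]

/-- Induction on `i`. An element of `B ⊗ F_{i+1}` is a contribution of `B ⊗ F_i` plus `b ⊗ x_i`. If
its image vanishes, `b` lies in the colon ideal over `B`, which `hB` places in the extension of `P
i`; then `b ⊗ x_i` also comes from `B ⊗ F_i`, where the induction hypothesis applies. -/
theorem lTensor_chainSubmodule_injective {J : Ideal A} {K : Ideal B} {t : ℕ} {x : Fin t → A}
    {P : Fin t → Ideal A} (e : (B ⊗[A] (A ⧸ J)) ≃ₗ[B] (B ⧸ K))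
    (he : ∀ (b : B) (r : A),
      e (b ⊗ₜ[A] Ideal.Quotient.mk J r) = Ideal.Quotient.mk K (b * algebraMap A B r))
    (hA : ∀ i, ∀ r ∈ P i, Ideal.Quotient.mk J (r * x i) ∈ chainSubmodule J x i)
    (hB : ∀ (i : Fin t) b, Ideal.Quotient.mk K (b * algebraMap A B (x i)) ∈
      chainSubmodule K (fun h => algebraMap A B (x h)) i → b ∈ (P i).map (algebraMap A B))
    (i : ℕ) (hi : i ≤ t) :
    Function.Injective ((chainSubmodule J x i).subtype.lTensor B) := by
  induction i with
  | zero =>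
    have : Subsingleton (chainSubmodule J x 0) := by
      rw [chainSubmodule_zero]; infer_instance
    exact Function.injective_of_subsingleton _
  | succ i ih =>
    have ih := ih (by omega)
    let i' : Fin t := ⟨i, by omega⟩
    have hle : chainSubmodule J x i ≤ chainSubmodule J x (i + 1) :=
      chainSubmodule_mono J x (Nat.le_succ i)
    let y : chainSubmodule J x (i + 1) := ⟨_, mk_mem_chainSubmodule_succ J x i'⟩
    let ι := (Submodule.inclusion hle).baseChange B
    have hι : ∀ z, (chainSubmodule J x (i + 1)).subtype.lTensor B (ι z) =
        (chainSubmodule J x i).subtype.lTensor B z := fun z => by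
      have : (chainSubmodule J x (i + 1)).subtype ∘ₗ Submodule.inclusion hle =
          (chainSubmodule J x i).subtype := rfl
      rw [← this, LinearMap.lTensor_comp]
      rfl
    have hdec : ∀ z : B ⊗[A] chainSubmodule J x (i + 1), ∃ z' b, z = ι z' + b ⊗ₜ y := by
      intro z
      induction z using TensorProduct.induction_on with
      | zero => exact ⟨0, 0, by simp⟩
      | add z w hz hw =>
        obtain ⟨z', b, rfl⟩ := hz
        obtain ⟨w', c, rfl⟩ := hw
        exact ⟨z' + w', b + c, by rw [map_add, TensorProduct.add_tmul]; abel⟩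
      | tmul b m =>
        obtain ⟨m, hm⟩ := m
        have hm' := hm
        have hsucc := chainSubmodule_succ J x i'
        simp only [i'] at hsucc
        rw [hsucc, Submodule.mem_sup] at hm'
        obtain ⟨m₁, h₁, m₂, h₂, rfl⟩ := hm'
        obtain ⟨r, rfl⟩ := Submodule.mem_span_singleton.1 h₂
        refine ⟨b ⊗ₜ ⟨m₁, h₁⟩, r • b, ?_⟩
        rw [TensorProduct.smul_tmul]
        change _ = b ⊗ₜ (Submodule.inclusion hle ⟨m₁, h₁⟩) + _
        rw [← TensorProduct.tmul_add]
        rfl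
    have hP : ∀ b ∈ (P i').map (algebraMap A B), ∃ z', b ⊗ₜ[A] y = ι z' := by
      intro b hb
      have : b ∈ ((LinearMap.range ι).comap
          ((TensorProduct.AlgebraTensorModule.mk A B B _).flip y)) := by
        revert b
        change Ideal.span _ ≤ _
        rw [Ideal.span_le]
        rintro _ ⟨p, hp, rfl⟩
        refine ⟨1 ⊗ₜ ⟨_, hA i' p hp⟩, ?_⟩
        change 1 ⊗ₜ (Submodule.inclusion hle _) = algebraMap A B p ⊗ₜ y
        rw [Algebra.algebraMap_eq_smul_one, TensorProduct.smul_tmul]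
        rfl
      obtain ⟨z', hz'⟩ := this
      exact ⟨z', hz'.symm⟩
    rw [injective_iff_map_eq_zero]
    intro z hz
    obtain ⟨z', b, rfl⟩ := hdec z
    have hb : b ∈ (P i').map (algebraMap A B) := by
      apply hB i'
      rw [isBaseChange_chainSubmodule e he]
      rw [map_add, hι] at hz
      refine ⟨-((chainSubmodule J x i).subtype.lTensor B z'), ?_, ?_⟩
      · refine Submodule.neg_mem _ ?_
        exact ⟨z', rfl⟩
      · rw [neg_eq_of_add_eq_zero_right hz, ← he]
        rfl
    obtain ⟨w, hw⟩ := hP b hb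
    rw [hw, ← map_add] at hz ⊢
    rw [hι] at hz
    rw [(injective_iff_map_eq_zero _).1 ih _ hz, map_zero]

end BaseChange

theorem isBaseChangeChain_chainSubmodule {A B : Type*} [CommRing A] [CommRing B] (f : A →+* B)
    {J : Ideal A} {K : Ideal B} (hK : K = J.map f) {t : ℕ} {x : Fin t → A} {y : Fin t → B}
    (hxy : ∀ i, y i = f (x i)) {P : Fin t → Ideal A}
    (hA : ∀ i, ∀ r ∈ P i, Ideal.Quotient.mk J (r * x i) ∈ chainSubmodule J x i)
    (hB : ∀ (i : Fin t) b, Ideal.Quotient.mk K (b * y i) ∈ chainSubmodule K y i → b ∈ (P i).map f) :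
    IsBaseChangeChain f (fun i : Fin (t + 1) => chainSubmodule J x i)
      (fun i : Fin (t + 1) => chainSubmodule K y i) := by
  let _ : Algebra A B := f.toAlgebra
  obtain rfl : y = fun h => algebraMap A B (x h) := funext hxy
  obtain ⟨e, he⟩ := exists_quotTensorEquiv J K hK
  exact ⟨e, he, fun i => ⟨lTensor_chainSubmodule_injective e he hA hB i (by omega),
    isBaseChange_chainSubmodule e he i⟩⟩

/-! ### Heads of a lower set of sequences and their colon ideals. -/

section Sequences

variable {n d : ℕ} {W : Type*}

/-- The exponent vector of `∏_{l, v_l < c} f(v_l, l)`. -/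
def seqExp (f : Fin n × Fin d → W) (c : ℕ) (v : Fin d → ℕ) : W →₀ ℕ :=
  ∑ l, if h : v l < n then if v l < c then Finsupp.single (f (⟨v l, h⟩, l)) 1 else 0 else 0

open Classical in
/-- The variables `f(i, j)` such that inserting the letter `i` into the non-decreasing sequence `v`
puts it into position `j`, in front of a greater letter. -/
def insertSet (f : Fin n × Fin d → W) (v : Fin d → ℕ) : Finset W :=
  (Finset.univ.filter fun q : Fin n × Fin d => q.1.val < v q.2 ∧ ∀ l < q.2, v l ≤ q.1).image f

/-- The greatest value of a sequence (`0` for the empty sequence). -/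
def maxVal (v : Fin d → ℕ) : ℕ := Finset.univ.sup v

theorem le_maxVal (v : Fin d → ℕ) (l : Fin d) : v l ≤ maxVal v :=
  Finset.le_sup (f := v) (Finset.mem_univ l)

theorem maxVal_le {v : Fin d → ℕ} {c : ℕ} (h : ∀ l, v l ≤ c) : maxVal v ≤ c :=
  Finset.sup_le fun l _ => h l

theorem lt_maxVal {v : Fin d → ℕ} {i : ℕ} (h : i < maxVal v) : ∃ l, i < v l := by
  simpa using (Finset.lt_sup_iff).1 h

/-- A variable assignment which identifies `(i, j)` and `(i', j')` if and only if
`i + a_j = i' + a_{j'}`, where `a` is non-decreasing. -/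
structure IsShiftMap (f : Fin n × Fin d → W) (a : Fin d → ℕ) : Prop where
  mono : Monotone a
  eq_iff : ∀ q q', f q = f q' ↔ q.1.val + a q.2 = q'.1.val + a q'.2

theorem seqExp_mapDomain {W' : Type*} (f : Fin n × Fin d → W) (φ : W → W') (c : ℕ)
    (v : Fin d → ℕ) : (seqExp f c v).mapDomain φ = seqExp (φ ∘ f) c v := by
  rw [seqExp, Finsupp.mapDomain_finsetSum]
  refine Finset.sum_congr rfl fun l _ => ?_
  split_ifs <;> simp [Finsupp.mapDomain_single]

theorem insertSet_comp {W' : Type*} [DecidableEq W'] (f : Fin n × Fin d → W) (φ : W → W')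
    (v : Fin d → ℕ) : (insertSet f v).image φ = insertSet (φ ∘ f) v := by
  classical
  rw [insertSet, insertSet, Finset.image_image]
  congr!

theorem mem_insertSet {f : Fin n × Fin d → W} {v : Fin d → ℕ} {b : W} :
    b ∈ insertSet f v ↔ ∃ (i : Fin n) (j : Fin d), i.val < v j ∧ (∀ l < j, v l ≤ i) ∧ f (i, j) = b := by
  simp [insertSet, and_assoc]

theorem seqExp_apply {f : Fin n × Fin d → W} {a : Fin d → ℕ} (hf : IsShiftMap f a) {c : ℕ}
    (hc : c ≤ n) (v : Fin d → ℕ) (i : Fin n) (j : Fin d) :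
    seqExp f c v (f (i, j)) =
      (Finset.univ.filter fun l => v l < c ∧ v l + a l = i + a j).card := by
  classical
  rw [seqExp, Finsupp.finsetSum_apply, Finset.card_filter]
  refine Finset.sum_congr rfl fun l _ => ?_
  by_cases h : v l < c
  · have h' : v l < n := h.trans_le hc
    simp only [h, h', dif_pos, if_pos, Finsupp.single_apply, hf.eq_iff, true_and]
  · simp [h]

/-- Each letter `i` below the maximum has one insertion position, the first `j` with `v j > i`. The
map `f` identifies none of these: for `j < j'` one has `i < v j ≤ i'` and `a j ≤ a j'`. -/
theorem card_insertSet {f : Fin n × Fin d → W} {a : Fin d → ℕ} (hf : IsShiftMap f a)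
    {v : Fin d → ℕ} (hn : ∀ l, v l ≤ n) : (insertSet f v).card = maxVal v := by
  classical
  rw [insertSet, Finset.card_image_of_injOn, ← Finset.card_range (maxVal v)]
  · refine Finset.card_bij (fun q _ => q.1.val) ?_ ?_ ?_
    · intro q hq
      have := (Finset.mem_filter.1 hq).2.1
      exact Finset.mem_range.2 (this.trans_le (le_maxVal v _))
    · rintro ⟨i, j⟩ hq ⟨i', j'⟩ hq' heq
      obtain ⟨h1, h2⟩ := (Finset.mem_filter.1 hq).2
      obtain ⟨h1', h2'⟩ := (Finset.mem_filter.1 hq').2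
      obtain rfl : i = i' := Fin.ext heq
      rcases lt_trichotomy j j' with h | h | h
      · exact absurd (h2' j h) (not_le.2 h1)
      · rw [h]
      · exact absurd (h2 j' h) (not_le.2 h1')
    · intro i hi
      have hi := Finset.mem_range.1 hi
      have hne : (Finset.univ.filter fun l => i < v l).Nonempty := by
        obtain ⟨l, hl⟩ := lt_maxVal hi
        exact ⟨l, by simpa using hl⟩
      have hin : i < n := hi.trans_le (maxVal_le hn)
      refine ⟨(⟨i, hin⟩, Finset.min' _ hne), ?_, rfl⟩
      refine Finset.mem_filter.2 ⟨Finset.mem_univ _, ?_, ?_⟩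
      · exact (Finset.mem_filter.1 (Finset.min'_mem _ hne)).2
      · intro l hl
        by_contra hcon
        exact absurd (Finset.min'_le _ l (by simpa using hcon)) (not_le.2 hl)
  · rintro ⟨i, j⟩ hq ⟨i', j'⟩ hq' heq
    obtain ⟨h1, h2⟩ := (Finset.mem_filter.1 hq).2
    obtain ⟨h1', h2'⟩ := (Finset.mem_filter.1 hq').2
    rw [hf.eq_iff] at heq
    simp only at h1 h2 h1' h2' heq
    have aux : ∀ {i i' : Fin n} {j j' : Fin d}, i.val < v j → (∀ l < j', v l ≤ i') →
        i.val + a j = i' + a j' → j < j' → False := fun h1 h2' heq h => by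
      have h3 := hf.mono h.le
      have h4 := h2' _ h
      omega
    rcases lt_trichotomy j j' with h | h | h
    · exact (aux h1 h2' heq h).elim
    · subst h
      exact Prod.ext (Fin.ext (by simpa using heq)) rfl
    · exact (aux h1' h2 heq.symm h).elim

/-- At the first `l` with `h l < v l`, the variable `f(h l, l)` lies in `insertSet f v`, so `w` is
free of it. Every position `r` at which `v` yields this variable precedes `l` and has `v r = h r = h
l`, so `h` yields it there too. But `h` yields it at `l` as well, which contradicts divisibility. -/
theorem le_of_seqExp_le {f : Fin n × Fin d → W} {a : Fin d → ℕ} (hf : IsShiftMap f a)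
    {v h : Fin d → ℕ} (hv : Monotone v) (hh : Monotone h) {C : ℕ} (hC : C ≤ n)
    (hvC : maxVal v ≤ C) {w : W →₀ ℕ} (hw : Disjoint w.support (insertSet f v))
    (hle : seqExp f C h ≤ seqExp f (maxVal v) v + w) : v ≤ h := by
  classical
  intro l
  induction l using WellFoundedLT.induction with
  | ind l ih =>
  by_contra hcon
  have hlv : h l < v l := not_le.1 hcon
  have hvl := le_maxVal v l
  have hln : h l < n := by omega
  have hp : f (⟨h l, hln⟩, l) ∈ insertSet f v :=
    mem_insertSet.2 ⟨⟨h l, hln⟩, l, hlv, fun r hr => (ih r hr).trans (hh hr.le), rfl⟩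
  have hwp : w (f (⟨h l, hln⟩, l)) = 0 := by
    by_contra hne
    exact (Finset.disjoint_left.1 hw (Finsupp.mem_support_iff.2 hne)) hp
  have h1 := hle (f (⟨h l, hln⟩, l))
  rw [Finsupp.add_apply, hwp, add_zero, seqExp_apply hf hC, seqExp_apply hf (hvC.trans hC)] at h1
  refine absurd h1 (not_le.2 (Finset.card_lt_card ?_))
  rw [Finset.ssubset_iff_of_subset]
  · exact ⟨l, Finset.mem_filter.2 ⟨Finset.mem_univ _, by omega, rfl⟩, fun hl => by
      have := (Finset.mem_filter.1 hl).2.2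
      simp only at this
      omega⟩
  · intro r hr
    obtain ⟨hr1, hr2⟩ := (Finset.mem_filter.1 hr).2
    simp only at hr2
    have hrl : r < l := by
      by_contra hcon'
      have h2 := hf.mono (not_lt.1 hcon')
      have h3 := hv (not_lt.1 hcon')
      omega
    have h2 := hf.mono hrl.le
    have h3 : v r ≤ h r := ih r hrl
    have h4 := hh hrl.le
    refine Finset.mem_filter.2 ⟨Finset.mem_univ _, ?_, ?_⟩
    · omega
    · simp only; omega

/-- A lower set in the non-decreasing sequences with values in `{0, …, n}`. -/
structure IsSeqLowerSet (n : ℕ) (L : Set (Fin d → ℕ)) : Prop where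
  mono : ∀ v ∈ L, Monotone v
  le : ∀ v ∈ L, ∀ l, v l ≤ n
  lower : ∀ v w, Monotone v → v ≤ w → w ∈ L → v ∈ L

/-- The sequences outside `L` that enter `L` when their greatest value is lowered by one. -/
def heads (n : ℕ) (L : Set (Fin d → ℕ)) : Set (Fin d → ℕ) :=
  {v | Monotone v ∧ (∀ l, v l ≤ n) ∧ v ∉ L ∧
    (maxVal v = 0 ∨ (fun l => min (v l) (maxVal v - 1)) ∈ L)}

/-- Heads are ordered by decreasing greatest value, then by increasing sum. -/
def headKey (v : Fin d → ℕ) : ℕᵒᵈ ×ₗ ℕ := toLex (OrderDual.toDual (maxVal v), ∑ l, v l)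

theorem headKey_lt_iff {v w : Fin d → ℕ} :
    headKey v < headKey w ↔ maxVal w < maxVal v ∨ maxVal v = maxVal w ∧ ∑ l, v l < ∑ l, w l := by
  rw [headKey, headKey, Prod.Lex.toLex_lt_toLex]
  rfl

variable {L : Set (Fin d → ℕ)}

theorem min_const_mono {v : Fin d → ℕ} (hv : Monotone v) (c : ℕ) :
    Monotone fun l => min (v l) c :=
  fun _ _ h => min_le_min_right c (hv h)

/-- Capping a sequence outside `L` at the least possible level `≥ c` gives a sequence outside `L`
which either is capped at `c` or enters `L` when the cap is lowered. -/
theorem exists_cap {v : Fin d → ℕ} (hn : ∀ l, v l ≤ n) (hL : v ∉ L) {c : ℕ} (hc : c ≤ n) :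
    ∃ C, c ≤ C ∧ C ≤ n ∧ (fun l => min (v l) C) ∉ L ∧
      (C = c ∨ c < C ∧ (fun l => min (v l) (C - 1)) ∈ L) := by
  classical
  have hex : ∃ C, c ≤ C ∧ (fun l => min (v l) C) ∉ L :=
    ⟨n, hc, by simpa [min_eq_left (hn _)] using hL⟩
  obtain ⟨h1, h2⟩ := Nat.find_spec hex
  refine ⟨Nat.find hex, h1, Nat.find_min' hex ⟨hc, by simpa [min_eq_left (hn _)] using hL⟩, h2, ?_⟩
  rcases h1.eq_or_lt with h | h
  · exact Or.inl h.symm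
  · refine Or.inr ⟨h, ?_⟩
    by_contra hcon
    exact Nat.find_min hex (Nat.sub_one_lt (by omega)) ⟨by omega, hcon⟩

/-- Put `i` in place of the letter at position `j`. Either the new word lies in `L`, or a suitable
cap of it is a head that comes earlier: its maximum is larger, or equal with a smaller sum. -/
theorem heads_step (hL : IsSeqLowerSet n L) (f : Fin n × Fin d → W) {v : Fin d → ℕ}
    (hv : v ∈ heads n L) {b : W} (hb : b ∈ insertSet f v) :
    (∃ g ∈ L, seqExp f n g ≤ seqExp f (maxVal v) v + Finsupp.single b 1) ∨
      ∃ h ∈ heads n L, headKey h < headKey v ∧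
        seqExp f (maxVal h) h ≤ seqExp f (maxVal v) v + Finsupp.single b 1 := by
  classical
  obtain ⟨hmono, hn, hvL, hhead⟩ := hv
  obtain ⟨i, j, hij, hbefore, rfl⟩ := mem_insertSet.1 hb
  set c := maxVal v with hc
  have hcn : c ≤ n := maxVal_le hn
  have hvc : ∀ l, v l ≤ c := le_maxVal v
  have hic : i.val < c := hij.trans_le (hvc j)
  -- Here `c > i ≥ 0`, so the exceptional case of maximum `0` does not occur.
  have hlow : (fun l => min (v l) (c - 1)) ∈ L := hhead.resolve_left (by omega)
  -- The letters equal to `c`, absent from the monomial of `v`, become the padding `n`.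
  let v' : Fin d → ℕ := fun l => if l = j then i else if v l < c then v l else n
  have hv'j : v' j = i := by simp [v']
  have hv'lt : ∀ l, l ≠ j → v l < c → v' l = v l := fun l h1 h2 => by simp [v', h1, h2]
  have hv'n : ∀ l, l ≠ j → ¬ v l < c → v' l = n := fun l h1 h2 => by simp [v', h1, h2]
  have hv'le : ∀ l, v' l ≤ n := fun l => by
    by_cases h1 : l = j
    · subst h1; rw [hv'j]; exact i.2.le
    · by_cases h2 : v l < c
      · rw [hv'lt l h1 h2]; exact hn l
      · rw [hv'n l h1 h2]
  have hv'mono : Monotone v' := by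
    intro r s hrs
    rcases hrs.eq_or_lt with rfl | hrs
    · exact le_rfl
    have hvrs := hmono hrs.le
    by_cases hr : r = j
    · subst hr
      rw [hv'j]
      by_cases h2 : v s < c
      · rw [hv'lt s hrs.ne' h2]; omega
      · rw [hv'n s hrs.ne' h2]; exact i.2.le
    · by_cases hs : s = j
      · subst hs
        have := hbefore r hrs
        rw [hv'j, hv'lt r hr (by omega)]
        exact this
      · by_cases h2 : v s < c
        · rw [hv'lt s hs h2, hv'lt r hr (by omega)]; exact hvrs
        · rw [hv'n s hs h2]; exact hv'le r
  have key : ∀ (C : ℕ) (h : Fin d → ℕ), (∀ l, h l < C → h l = v' l ∧ v' l < n) →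
      seqExp f C h ≤ seqExp f c v + Finsupp.single (f (i, j)) 1 := by
    intro C h hh
    have hsingle : Finsupp.single (f (i, j)) 1 =
        ∑ l, if l = j then Finsupp.single (f (i, j)) 1 else (0 : W →₀ ℕ) := by simp
    rw [hsingle, seqExp, seqExp, ← Finset.sum_add_distrib]
    refine Finset.sum_le_sum fun l _ => ?_
    by_cases hlC : h l < C
    · obtain ⟨h1, h2⟩ := hh l hlC
      have hln : h l < n := h1 ▸ h2
      rw [dif_pos hln, if_pos hlC]
      by_cases hl : l = j
      · subst hl
        have h3 : (⟨h l, hln⟩ : Fin n) = i := Fin.ext (h1.trans hv'j)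
        rw [if_pos rfl, h3]
        exact le_add_self
      · have h3 : v l < c := by
          by_contra hcon
          exact absurd (hv'n l hl hcon) h2.ne
        have h4 : h l = v l := h1.trans (hv'lt l hl h3)
        have h5 : v l < n := h3.trans_le hcn
        rw [dif_pos h5, if_pos h3]
        simp only [h4]
        exact le_self_add
    · split_ifs <;> exact fun _ => Nat.zero_le _
  by_cases hv'L : v' ∈ L
  · exact Or.inl ⟨v', hv'L, key n v' fun l hl => ⟨rfl, hl⟩⟩
  right
  obtain ⟨C, hcC, hCn, hCL, hCc⟩ := exists_cap hv'le hv'L hcn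
  -- Without a padded position `v'` would lie below the lowered `v`, hence in `L`. The padding makes
  -- the maximum of the capped sequence exactly `C`.
  have hex : ∃ l, v' l = n := by
    by_contra hcon
    push Not at hcon
    refine hv'L (hL.lower _ _ hv'mono (fun l => ?_) hlow)
    change v' l ≤ min (v l) (c - 1)
    by_cases h1 : l = j
    · subst h1; rw [hv'j]; omega
    · by_cases h2 : v l < c
      · rw [hv'lt l h1 h2]; omega
      · exact absurd (hv'n l h1 h2) (hcon l)
  let h : Fin d → ℕ := fun l => min (v' l) C
  have hmax : maxVal h = C := by
    refine le_antisymm (maxVal_le fun l => min_le_right _ _) ?_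
    obtain ⟨l, hl⟩ := hex
    refine le_trans ?_ (le_maxVal h l)
    simp only [h, hl]
    exact le_min hCn le_rfl
  have hhv : C = c → h ≤ v := by
    intro hCc l
    simp only [h]
    by_cases h1 : l = j
    · subst h1; rw [hv'j]; omega
    · by_cases h2 : v l < c
      · rw [hv'lt l h1 h2]; omega
      · omega
  have hhmono : Monotone h := min_const_mono hv'mono C
  refine ⟨h, ⟨hhmono, fun l => (min_le_left _ _).trans (hv'le l), hCL, ?_⟩, ?_, ?_⟩
  · right
    rw [hmax]
    rcases hCc with hCc | ⟨hCc, hmem⟩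
    · refine hL.lower _ _ (min_const_mono hhmono _) (fun l => ?_) hlow
      simp only
      rw [hCc]
      exact min_le_min_right _ (hhv hCc l)
    · convert hmem using 2 with l
      simp only [h]
      omega
  · rw [headKey_lt_iff, hmax]
    rcases hCc with hCc | ⟨hCc, -⟩
    · refine Or.inr ⟨hCc, Finset.sum_lt_sum (fun l _ => hhv hCc l) ⟨j, Finset.mem_univ _, ?_⟩⟩
      simp only [h, hv'j]
      omega
    · exact Or.inl hCc
  · rw [hmax]
    refine key C h fun l hl => ?_
    simp only [h] at hl ⊢
    omega

/-- A constant sequence has no letter below its maximum, so as a head it contributes the monomial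
`1`; the constant is the least one outside `L`. -/
theorem heads_top (f : Fin n × Fin d → W) :
    (∃ g ∈ L, seqExp f n g = 0) ∨ ∃ h ∈ heads n L, seqExp f (maxVal h) h = 0 := by
  by_cases hmem : (fun _ => n) ∈ L
  · exact Or.inl ⟨_, hmem, by simp [seqExp]⟩
  right
  obtain ⟨C, -, hCn, hCL, hC⟩ := exists_cap (n := n) (fun _ => le_rfl) hmem (Nat.zero_le n)
  simp only [min_eq_right hCn] at hCL
  have hle : maxVal (fun _ : Fin d => C) ≤ C := maxVal_le fun _ => le_rfl
  refine ⟨fun _ => C, ⟨fun _ _ _ => le_rfl, fun _ => hCn, hCL, ?_⟩, ?_⟩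
  · rcases hC with rfl | ⟨hpos, hmem'⟩
    · exact Or.inl (Nat.le_zero.1 hle)
    · rcases isEmpty_or_nonempty (Fin d) with hd | ⟨⟨l⟩⟩
      · left
        simp [maxVal]
      · right
        have : maxVal (fun _ : Fin d => C) = C := le_antisymm hle (le_maxVal (fun _ => C) l)
        rw [this]
        convert hmem' using 2
        change min C (C - 1) = min n (C - 1)
        omega
  · rw [seqExp]
    refine Finset.sum_eq_zero fun l _ => ?_
    split_ifs with h₁ h₂
    · exact absurd h₂ (not_lt.2 hle)
    · rfl
    · rfl

theorem heads_finite : (heads n L).Finite :=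
  (Set.finite_Iic fun _ : Fin d => n).subset fun _ hv => hv.2.1

theorem exists_sorted_enumeration {α β : Type*} [LinearOrder β] {S : Set α} (hS : S.Finite)
    (key : α → β) :
    ∃ (t : ℕ) (s : Fin t → α), Function.Injective s ∧ Set.range s = S ∧ Monotone (key ∘ s) := by
  classical
  have := hS.to_subtype
  obtain ⟨t, ⟨e⟩⟩ := Finite.exists_equiv_fin S
  let s₀ : Fin t → α := fun i => e.symm i
  let σ := Tuple.sort (key ∘ s₀)
  refine ⟨t, s₀ ∘ σ, ?_, ?_, Tuple.monotone_sort (key ∘ s₀)⟩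
  · exact (Subtype.val_injective.comp e.symm.injective).comp σ.injective
  · rw [σ.surjective.range_comp]
    exact (e.symm.surjective.range_comp Subtype.val).trans Subtype.range_coe

theorem isVarColonSeq_seqExp (hL : IsSeqLowerSet n L) {f : Fin n × Fin d → W} {a : Fin d → ℕ}
    (hf : IsShiftMap f a) {t : ℕ} {s : Fin t → Fin d → ℕ} (hinj : Function.Injective s)
    (hrange : Set.range s = heads n L) (hkey : Monotone (headKey ∘ s)) :
    IsVarColonSeq (seqExp f n '' L) (fun i => seqExp f (maxVal (s i)) (s i))
      (fun i => insertSet f (s i)) := by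
  have hs : ∀ i, s i ∈ heads n L := fun i => hrange ▸ Set.mem_range_self i
  have hsn : ∀ i, maxVal (s i) ≤ n := fun i => maxVal_le (hs i).2.1
  refine ⟨?_, ?_, ?_, ?_, ?_⟩
  · intro i b hb
    rcases heads_step hL f (hs i) hb with ⟨g, hg, hle⟩ | ⟨h, hh, hlt, hle⟩
    · exact Or.inl ⟨_, ⟨g, hg, rfl⟩, hle⟩
    · rw [← hrange] at hh
      obtain ⟨j, rfl⟩ := hh
      exact Or.inr ⟨j, not_le.1 fun hji => absurd (hkey hji) (not_le.2 hlt), hle⟩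
  · rintro i w hw _ ⟨g, hg, rfl⟩ hle
    exact (hs i).2.2.1 (hL.lower _ _ (hs i).1
      (le_of_seqExp_le hf (hs i).1 (hL.mono g hg) le_rfl (hsn i) hw hle) hg)
  · intro i w hw h hhi hle
    have hk : headKey (s h) ≤ headKey (s i) := hkey hhi.le
    have hk' := not_lt.2 hk
    rw [headKey_lt_iff] at hk'
    push Not at hk'
    obtain ⟨hmax, hsum⟩ := hk'
    have hle' := le_of_seqExp_le hf (hs i).1 (hs h).1 (hsn h) hmax hw hle
    rcases hmax.eq_or_lt with heq | hlt
    · have h1 := hsum heq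
      refine hhi.ne (hinj ?_)
      have h2 : ∑ l, s i l = ∑ l, s h l :=
        le_antisymm (Finset.sum_le_sum fun l _ => hle' l) h1
      rw [Finset.sum_eq_sum_iff_of_le fun l _ => hle' l] at h2
      exact funext fun l => (h2 l (Finset.mem_univ l)).symm
    -- Since `s i ≤ s h` and the maximum of `s h` is strictly larger, `s i` lies below the lowered
    -- `s h`, which is in `L`.
    · obtain ⟨-, -, -, hhead⟩ := hs h
      refine (hs i).2.2.1 (hL.lower _ _ (hs i).1 (fun l => ?_) (hhead.resolve_left (by omega)))
      have h1 := hle' l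
      have h2 := le_maxVal (s i) l
      exact le_min h1 (Nat.le_sub_one_of_lt (h2.trans_lt hlt))
  · rcases heads_top (L := L) f with ⟨g, hg, h0⟩ | ⟨h, hh, h0⟩
    · exact Or.inl ⟨g, hg, h0⟩
    · rw [← hrange] at hh
      obtain ⟨i, rfl⟩ := hh
      exact Or.inr ⟨i, h0⟩
  · intro i j hij
    simp only
    rw [card_insertSet hf (hs i).2.1, card_insertSet hf (hs j).2.1]
    have hk' := not_lt.2 (show headKey (s i) ≤ headKey (s j) from hkey hij)
    rw [headKey_lt_iff] at hk'
    push Not at hk'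
    exact hk'.1

end Sequences

/-! ### Translation between monomials and padded sequences. -/

section Words

variable {n d : ℕ} {W : Type*}

theorem toMultiset_sum_single {e : ℕ} (s : Fin e → Fin n) :
    Finsupp.toMultiset (∑ l, Finsupp.single (s l) 1) = (List.ofFn s : Multiset (Fin n)) := by
  rw [map_sum]
  simp only [Finsupp.toMultiset_single, one_smul]
  rw [← Fin.univ_val_map, ← Multiset.sum_map_singleton (Multiset.map s _), Multiset.map_map]
  rfl

theorem alphaSeq_sum_single {e : ℕ} {s : Fin e → Fin n} (hs : Monotone s) :
    alphaSeq (∑ l, Finsupp.single (s l) 1) = List.ofFn s := by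
  rw [alphaSeq, toMultiset_sum_single]
  refine List.Perm.eq_of_pairwise' (Multiset.pairwise_sort _ _) ?_ ?_
  · exact hs.sortedLE_ofFn.pairwise
  · rw [← Multiset.coe_eq_coe, Multiset.sort_eq]

theorem length_alphaSeq (m : Fin n →₀ ℕ) : (alphaSeq m).length = m.degree := by
  rw [alphaSeq, Multiset.length_sort, Finsupp.card_toMultiset]
  rfl

theorem monotone_alphaSeq_get (m : Fin n →₀ ℕ) : Monotone (alphaSeq m).get :=
  (Multiset.pairwise_sort _ _).sortedLE.monotone_get

theorem sum_single_alphaSeq_get (m : Fin n →₀ ℕ) :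
    ∑ l, Finsupp.single ((alphaSeq m).get l) 1 = m := by
  have h : (List.ofFn (alphaSeq m).get : Multiset (Fin n)) = Finsupp.toMultiset m := by
    rw [List.ofFn_get]
    exact Multiset.sort_eq _ _
  rw [← toMultiset_sum_single, Finsupp.toMultiset_eq_iff, Finsupp.toMultiset_toFinsupp] at h
  exact h

variable (k : Type*) [Field k]

theorem boxMonomial_sum_single {e : ℕ} (he : e ≤ d) {s : Fin e → Fin n} (hs : Monotone s) :
    boxMonomial k d (∑ l, Finsupp.single (s l) 1) =
      monomial (∑ l, Finsupp.single (s l, Fin.castLE he l) 1) 1 := by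
  have hlist : ∀ L : List (Fin n), alphaSeq (∑ l, Finsupp.single (s l) 1) = L →
      boxMonomial k d (∑ l, Finsupp.single (s l) 1) =
        ∏ p : Fin L.length, if h : p.val < d then X (L.get p, ⟨p.val, h⟩) else 1 := by
    rintro _ rfl
    rfl
  rw [hlist _ (alphaSeq_sum_single hs), monomial_sum_one]
  refine Fintype.prod_equiv (finCongr (List.length_ofFn)) _ _ fun p => ?_
  have hp : p.val < d := lt_of_lt_of_le (lt_of_lt_of_eq p.2 List.length_ofFn) he
  rw [dif_pos hp, List.get_ofFn]
  rfl

/-- The sequence `s_0, …, s_{e-1}, n, n, …`. -/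
def padSeq (d : ℕ) {e : ℕ} (s : Fin e → Fin n) (l : Fin d) : ℕ :=
  if h : l.val < e then s ⟨l, h⟩ else n

theorem padSeq_le {e : ℕ} (s : Fin e → Fin n) (l : Fin d) : padSeq d s l ≤ n := by
  rw [padSeq]
  split_ifs
  · exact (s _).2.le
  · exact le_rfl

theorem padSeq_mono {e : ℕ} {s : Fin e → Fin n} (hs : Monotone s) : Monotone (padSeq d s) := by
  intro l r hlr
  rw [padSeq, padSeq]
  have hlr' : l.val ≤ r.val := hlr
  split_ifs with h1 h2 h2
  · exact hs hlr
  · exact (s _).2.le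
  · omega
  · exact le_rfl

theorem exists_eq_padSeq {v : Fin d → ℕ} (hv : Monotone v) (hn : ∀ l, v l ≤ n) :
    ∃ (e : ℕ) (_ : e ≤ d) (s : Fin e → Fin n), Monotone s ∧ v = padSeq d s := by
  classical
  have hex : ∃ e, ∀ l : Fin d, v l < n → l.val < e := ⟨d, fun l _ => l.2⟩
  have he : Nat.find hex ≤ d := Nat.find_min' hex fun l _ => l.2
  have hlt : ∀ l : Fin d, l.val < Nat.find hex → v l < n := by
    intro l hl
    have h1 := Nat.find_min hex (Nat.sub_one_lt (by omega : Nat.find hex ≠ 0))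
    push Not at h1
    obtain ⟨r, hr, hr'⟩ := h1
    exact (hv (show l ≤ r from Fin.le_def.2 (by omega))).trans_lt hr
  refine ⟨Nat.find hex, he, fun l => ⟨v (Fin.castLE he l), hlt _ l.2⟩, ?_, ?_⟩
  · exact fun l r hlr => hv hlr
  · funext l
    rw [padSeq]
    split_ifs with h
    · rfl
    · exact le_antisymm (hn l) (not_lt.1 fun h' => h (Nat.find_spec hex l h'))

theorem seqExp_padSeq (f : Fin n × Fin d → W) {e : ℕ} (he : e ≤ d) (s : Fin e → Fin n) :
    seqExp f n (padSeq d s) = ∑ l, Finsupp.single (f (s l, Fin.castLE he l)) 1 := by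
  obtain ⟨r, rfl⟩ := Nat.exists_eq_add_of_le he
  rw [seqExp, Fin.sum_univ_add, Finset.sum_eq_zero (s := (Finset.univ : Finset (Fin r))), add_zero]
  · refine Finset.sum_congr rfl fun l _ => ?_
    have h1 : padSeq (e + r) s (Fin.castAdd r l) = s l := by
      rw [padSeq, dif_pos (by simp)]; rfl
    simp [h1]
    rfl
  · intro l _
    have h1 : padSeq (e + r) s (Fin.natAdd e l) = n := by
      rw [padSeq, dif_neg (by simp)]
    simp [h1]

theorem boxMonomial_seqExp {v : Fin d → ℕ} (hv : Monotone v) (hn : ∀ l, v l ≤ n) :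
    boxMonomial k d (seqExp (Prod.fst : Fin n × Fin d → Fin n) n v) =
      monomial (seqExp (id : Fin n × Fin d → _) n v) 1 := by
  obtain ⟨e, he, s, hs, rfl⟩ := exists_eq_padSeq hv hn
  rw [seqExp_padSeq _ he, seqExp_padSeq _ he]
  exact boxMonomial_sum_single k he hs

theorem exists_seqExp_eq {m : Fin n →₀ ℕ} (hm : m.degree ≤ d) :
    ∃ v : Fin d → ℕ, Monotone v ∧ (∀ l, v l ≤ n) ∧
      seqExp (Prod.fst : Fin n × Fin d → Fin n) n v = m := by
  refine ⟨padSeq d (alphaSeq m).get, padSeq_mono (monotone_alphaSeq_get m), padSeq_le _, ?_⟩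
  rw [seqExp_padSeq _ (length_alphaSeq m ▸ hm)]
  exact sum_single_alphaSeq_get m

theorem seqExp_update (f : Fin n × Fin d → W) (v : Fin d → ℕ) (l : Fin d) :
    ∃ R : W →₀ ℕ, ∀ x, seqExp f n (Function.update v l x) =
      R + if h : x < n then Finsupp.single (f (⟨x, h⟩, l)) 1 else 0 := by
  classical
  refine ⟨∑ r ∈ Finset.univ.erase l, if h : v r < n then if v r < n then
    Finsupp.single (f (⟨v r, h⟩, r)) 1 else 0 else 0, fun x => ?_⟩
  rw [seqExp, ← Finset.sum_erase_add _ _ (Finset.mem_univ l)]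
  congr 1
  · refine Finset.sum_congr rfl fun r hr => ?_
    simp only [Function.update_of_ne (Finset.ne_of_mem_erase hr)]
  · simp only [Function.update_self]
    split_ifs <;> rfl

end Words

/-! ### Borel fixed ideals as lower sets of sequences. -/

section BorelIdeals

variable {k : Type*} [Field k] {n d : ℕ} {I : Ideal (MvPolynomial (Fin n) k)}

/-- The non-decreasing sequences of length `d` that represent monomials in `I`. -/
def seqSet (d : ℕ) (I : Ideal (MvPolynomial (Fin n) k)) : Set (Fin d → ℕ) :=
  {v | Monotone v ∧ (∀ l, v l ≤ n) ∧
    monomial (seqExp (Prod.fst : Fin n × Fin d → Fin n) n v) (1 : k) ∈ I}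

theorem monomial_mem_of_le {W : Type*} {I : Ideal (MvPolynomial W k)} {m m' : W →₀ ℕ} (h : m ≤ m')
    (hm : monomial m (1 : k) ∈ I) : monomial m' (1 : k) ∈ I :=
  Ideal.mem_of_dvd I (monomial_dvd_monomial.2 ⟨Or.inr h, dvd_rfl⟩) hm

/-- Lowering an actual letter is a Borel move; lowering a padding value multiplies the monomial by a
letter or by `1`. -/
theorem IsBorelFixed.update_mem (hI : IsBorelFixed I) {v : Fin d → ℕ} {l : Fin d} {x : ℕ}
    (hx : x ≤ v l)
    (hv : monomial (seqExp (Prod.fst : Fin n × Fin d → Fin n) n v) (1 : k) ∈ I) :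
    monomial (seqExp (Prod.fst : Fin n × Fin d → Fin n) n (Function.update v l x)) (1 : k) ∈ I := by
  obtain ⟨R, hR⟩ := seqExp_update (Prod.fst : Fin n × Fin d → Fin n) v l
  rw [← Function.update_eq_self l v, hR] at hv
  rw [hR]
  by_cases hvn : v l < n
  · have hxn : x < n := hx.trans_lt hvn
    rw [dif_pos hvn] at hv
    rw [dif_pos hxn]
    rcases hx.eq_or_lt with rfl | hlt
    · exact hv
    · have := hI.2 _ hv ⟨v l, hvn⟩ ⟨x, hxn⟩ (by simp) hlt
      rwa [add_tsub_cancel_right] at this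
  · rw [dif_neg hvn, add_zero] at hv
    exact monomial_mem_of_le le_self_add hv

/-- The positions change one at a time; the intermediate sequences need not be monotone, so
membership is stated for arbitrary sequences. -/
theorem IsBorelFixed.mem_of_seq_le (hI : IsBorelFixed I) {v w : Fin d → ℕ} (hvw : v ≤ w)
    (hw : monomial (seqExp (Prod.fst : Fin n × Fin d → Fin n) n w) (1 : k) ∈ I) :
    monomial (seqExp (Prod.fst : Fin n × Fin d → Fin n) n v) (1 : k) ∈ I := by
  classical
  have key : ∀ s : Finset (Fin d),
      monomial (seqExp (Prod.fst : Fin n × Fin d → Fin n) n (s.piecewise v w)) (1 : k) ∈ I := by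
    intro s
    induction s using Finset.induction_on with
    | empty => simpa using hw
    | insert l s hl ih =>
      rw [Finset.piecewise_insert]
      refine hI.update_mem ?_ ih
      rw [Finset.piecewise_eq_of_notMem _ _ _ hl]
      exact hvw l
  simpa using key Finset.univ

theorem IsBorelFixed.isSeqLowerSet (hI : IsBorelFixed I) : IsSeqLowerSet n (seqSet d I) where
  mono _ hv := hv.1
  le _ hv := hv.2.1
  lower _ _ hv hvw hw := ⟨hv, fun l => (hvw l).trans (hw.2.1 l), hI.mem_of_seq_le hvw hw.2.2⟩

/-- The sequence `v_0, …, v_{e-1}, n, n, …`. -/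
def truncSeq (n e : ℕ) (v : Fin d → ℕ) (l : Fin d) : ℕ := if l.val < e then v l else n

theorem truncSeq_mono {v : Fin d → ℕ} (hv : Monotone v) (hn : ∀ l, v l ≤ n) (e : ℕ) :
    Monotone (truncSeq n e v) := by
  intro l r hlr
  have hlr' : l.val ≤ r.val := hlr
  rw [truncSeq, truncSeq]
  split_ifs
  · exact hv hlr
  · exact hn l
  · omega
  · exact le_rfl

theorem truncSeq_le {v : Fin d → ℕ} (hn : ∀ l, v l ≤ n) (e : ℕ) (l : Fin d) :
    truncSeq n e v l ≤ n := by
  rw [truncSeq]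
  split_ifs
  · exact hn l
  · exact le_rfl

theorem truncSeq_succ (v : Fin d → ℕ) {l : Fin d} :
    truncSeq n (l + 1) v = Function.update (truncSeq n l v) l (v l) := by
  funext r
  by_cases h : r = l
  · subst h; simp [truncSeq]
  · have : r.val ≠ l.val := fun h' => h (Fin.ext h')
    rw [Function.update_of_ne h, truncSeq, truncSeq]
    congr 1
    exact propext (by omega)

theorem seqExp_truncSeq_le {W : Type*} (f : Fin n × Fin d → W) (v : Fin d → ℕ) (e : ℕ) :
    seqExp f n (truncSeq n e v) ≤ seqExp f n v := by
  refine Finset.sum_le_sum fun l _ => ?_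
  by_cases h : l.val < e
  · simp [truncSeq, h]
  · simp [truncSeq, h]

theorem seqExp_fst_ne_zero {v : Fin d → ℕ} {i : Fin n}
    (h : seqExp (Prod.fst : Fin n × Fin d → Fin n) n v i ≠ 0) : ∃ l, v l = i := by
  rw [seqExp, Finsupp.finsetSum_apply] at h
  obtain ⟨l, -, hl⟩ := Finset.exists_ne_zero_of_sum_ne_zero h
  refine ⟨l, ?_⟩
  by_contra hne
  apply hl
  split_ifs with h1
  · rw [Finsupp.single_apply, if_neg]
    rintro rfl
    exact hne rfl
  · rfl

/-- Every monomial of a Borel fixed ideal has an initial part which is a minimal generator. -/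
theorem IsBorelFixed.exists_truncSeq_minGens (hI : IsBorelFixed I) {v : Fin d → ℕ}
    (hv : v ∈ seqSet d I) :
    ∃ e, seqExp (Prod.fst : Fin n × Fin d → Fin n) n (truncSeq n e v) ∈ minGens I := by
  classical
  obtain ⟨hmono, hn, hvI⟩ := hv
  have htrunc : truncSeq n d v = v := funext fun l => if_pos l.2
  have hex : ∃ e,
      monomial (seqExp (Prod.fst : Fin n × Fin d → Fin n) n (truncSeq n e v)) (1 : k) ∈ I :=
    ⟨d, by rwa [htrunc]⟩
  have hd : Nat.find hex ≤ d := Nat.find_min' hex (by rwa [htrunc])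
  refine ⟨Nat.find hex, Nat.find_spec hex, fun m hm hle => ?_⟩
  by_contra hcon
  obtain ⟨i, hi⟩ : ∃ i, m i <
      seqExp (Prod.fst : Fin n × Fin d → Fin n) n (truncSeq n (Nat.find hex) v) i := by
    by_contra hall
    push Not at hall
    exact hcon hall
  obtain ⟨r, hr⟩ := seqExp_fst_ne_zero (Nat.ne_zero_of_lt hi)
  have hre : r.val < Nat.find hex := by
    by_contra hre
    rw [truncSeq, if_neg hre] at hr
    exact absurd i.2 (not_lt.2 hr.le)
  rw [truncSeq, if_pos hre] at hr
  let l : Fin d := ⟨Nat.find hex - 1, by omega⟩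
  have hle' : Nat.find hex = l.val + 1 := by simp only [l]; omega
  have hrl : r ≤ l := Fin.le_def.2 (by omega)
  have hnot := Nat.find_min hex (m := l.val) (by omega)
  rw [hle', truncSeq_succ] at hle hi
  obtain ⟨R, hR⟩ := seqExp_update (Prod.fst : Fin n × Fin d → Fin n) (truncSeq n l v) l
  have hself : truncSeq n l v l = n := by simp [truncSeq]
  have hRI : monomial R (1 : k) ∉ I := by
    rwa [← Function.update_eq_self l (truncSeq n l v), hR, hself, dif_neg (lt_irrefl n),
      add_zero] at hnot
  rw [hR] at hle hi
  by_cases hvn : v l < n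
  · rw [dif_pos hvn] at hle hi
    change m ≤ R + Finsupp.single ⟨v l, hvn⟩ 1 at hle
    change m i < (R + Finsupp.single ⟨v l, hvn⟩ 1 : Fin n →₀ ℕ) i at hi
    -- The shortest initial part in `I` is `R` times its last letter `v l`. A proper divisor `m` in
    -- `I` misses some letter `i ≤ v l`; exchanging `v l` for `i` then shows `R ∈ I`, against the
    -- choice of the shortest part.
    have hmle : m ≤ R + Finsupp.single ⟨v l, hvn⟩ 1 - Finsupp.single i 1 := by
      intro j
      have h1 := hle j
      rw [Finsupp.tsub_apply]
      by_cases hji : i = j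
      · subst hji
        rw [Finsupp.single_eq_same]
        omega
      · rw [Finsupp.single_apply, if_neg hji]
        exact h1
    have hmem := monomial_mem_of_le hmle hm
    have hil : i.val ≤ v l := hr ▸ hmono hrl
    rcases hil.eq_or_lt with heq | hlt
    · have : i = ⟨v l, hvn⟩ := Fin.ext heq
      rw [this, add_tsub_cancel_right] at hmem
      exact hRI hmem
    · have hne : (⟨v l, hvn⟩ : Fin n) ≠ i := fun h => by
        rw [← h] at hlt; exact lt_irrefl _ hlt
      have hb := hI.2 _ hmem ⟨v l, hvn⟩ i (by
        rw [Finsupp.tsub_apply, Finsupp.add_apply, Finsupp.single_eq_same,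
          Finsupp.single_apply, if_neg hne.symm]
        omega) hlt
      have hRi : R i ≠ 0 := by
        intro h0
        rw [Finsupp.add_apply, h0, Finsupp.single_apply, if_neg hne] at hi
        omega
      refine hRI ?_
      have hReq : R = R + Finsupp.single ⟨v l, hvn⟩ 1 - Finsupp.single i 1 -
          Finsupp.single ⟨v l, hvn⟩ 1 + Finsupp.single i 1 := by
        ext j
        simp only [Finsupp.add_apply, Finsupp.tsub_apply, Finsupp.single_apply]
        by_cases h1 : i = j
        · subst h1
          simp only [if_neg hne, if_true]
          omega
        · simp only [if_neg h1]
          omega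
      rw [hReq]
      exact hb
  · rw [dif_neg hvn, add_zero] at hle
    exact hRI (monomial_mem_of_le hle hm)

/-- The full lower set may replace the minimal generators: an initial part of a sequence keeps the
positions of its letters, so its box monomial divides that of the sequence. -/
theorem IsBorelFixed.boxIdeal_eq (hI : IsBorelFixed I) (hdeg : ∀ m ∈ minGens I, m.degree ≤ d) :
    boxIdeal d I = monoIdeal k (seqExp (id : Fin n × Fin d → _) n '' seqSet d I) := by
  apply le_antisymm
  · rw [boxIdeal, Ideal.span_le]
    rintro _ ⟨m, hm, rfl⟩
    obtain ⟨v, hv, hn, rfl⟩ := exists_seqExp_eq (hdeg m hm)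
    rw [boxMonomial_seqExp k hv hn]
    exact Ideal.subset_span ⟨_, ⟨v, ⟨hv, hn, hm.1⟩, rfl⟩, rfl⟩
  · rw [monoIdeal, Ideal.span_le]
    rintro _ ⟨_, ⟨v, hv, rfl⟩, rfl⟩
    obtain ⟨e, he⟩ := hI.exists_truncSeq_minGens hv
    refine monomial_mem_of_le (seqExp_truncSeq_le _ v e) ?_
    rw [← boxMonomial_seqExp k (truncSeq_mono hv.1 hv.2.1 e) (truncSeq_le hv.2.1 e)]
    exact Ideal.subset_span ⟨_, he, rfl⟩

end BorelIdeals

/-! ### The homomorphism `psi`, its kernel, and the ideal in `T`. -/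

section Specialization

variable (k : Type*) [Field k] {n d N : ℕ} {a : ℕ → ℕ}

theorem shift_lt (ha : Monotone a) (hN : n + a (d - 1) ≤ N) (q : Fin n × Fin d) :
    q.1.val + a q.2.val < N := by
  have h1 : a q.2.val ≤ a (d - 1) := ha (by omega)
  omega

/-- The map on variables which underlies `ψ`. -/
def shiftMap (ha : Monotone a) (hN : n + a (d - 1) ≤ N) (q : Fin n × Fin d) : Fin N :=
  ⟨q.1.val + a q.2.val, shift_lt ha hN q⟩

theorem psi_eq_rename (ha : Monotone a) (hN : n + a (d - 1) ≤ N) :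
    psi k n d N a = rename (shiftMap ha hN) := by
  refine algHom_ext fun q => ?_
  rw [psi, aeval_X, varT, dif_pos (shift_lt ha hN q), rename_X]
  rfl

theorem isShiftMap_shiftMap (ha : Monotone a) (hN : n + a (d - 1) ≤ N) :
    IsShiftMap (shiftMap ha hN) (fun j : Fin d => a j) where
  mono _ _ h := ha h
  eq_iff q q' := by simp [shiftMap]

/-- The numbers `i + n * j` with `i < n` are distinct by division with remainder, so the box ring is
a shift without identifications. -/
theorem isShiftMap_id : IsShiftMap (id : Fin n × Fin d → _) (fun j => n * j) where
  mono _ _ h := Nat.mul_le_mul_left n h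
  eq_iff q q' := by
    constructor
    · rintro h
      rw [show q = q' from h]
    · intro h
      have h1 := congrArg (· % n) h
      have h2 := congrArg (· / n) h
      have hn : 0 < n := q.1.pos
      simp only [Nat.add_mul_mod_self_left, Nat.mod_eq_of_lt q.1.2, Nat.mod_eq_of_lt q'.1.2] at h1
      simp only [Nat.add_mul_div_left _ _ hn, Nat.div_eq_of_lt q.1.2, Nat.div_eq_of_lt q'.1.2,
        zero_add] at h2
      exact Prod.ext (Fin.ext h1) (Fin.ext h2)

theorem sigmaMonomial_eq_psi (N : ℕ) (a : ℕ → ℕ) {m : Fin n →₀ ℕ} (hm : m.degree ≤ d) :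
    sigmaMonomial k N a m = psi k n d N a (boxMonomial k d m) := by
  rw [sigmaMonomial, boxMonomial, map_prod]
  refine Finset.prod_congr rfl fun p _ => ?_
  have hp : p.val < d := p.2.trans_le (length_alphaSeq m ▸ hm)
  rw [dif_pos hp, psi, aeval_X]

variable {k}

theorem sigmaIdeal_eq_map (N : ℕ) (a : ℕ → ℕ) {I : Ideal (MvPolynomial (Fin n) k)}
    (hdeg : ∀ m ∈ minGens I, m.degree ≤ d) :
    sigmaIdeal N a I = (boxIdeal d I).map (psi k n d N a).toRingHom := by
  rw [sigmaIdeal, boxIdeal, Ideal.map_span, Set.image_image]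
  congr 1
  exact Set.image_congr fun m hm => sigmaMonomial_eq_psi k N a (hdeg m hm)

theorem map_rename_monoIdeal {V W : Type*} (f : V → W) (s : Set (V →₀ ℕ)) :
    (monoIdeal k s).map (rename f : MvPolynomial V k →ₐ[k] MvPolynomial W k).toRingHom =
      monoIdeal k (Finsupp.mapDomain f '' s) := by
  rw [monoIdeal, Ideal.map_span, Set.image_image, monoIdeal, Set.image_image]
  congr 1
  exact Set.image_congr fun m _ => rename_monomial f m 1

theorem map_rename_varIdeal {V W : Type*} [DecidableEq W] (f : V → W) (A : Finset V) :
    (varIdeal k A).map (rename f : MvPolynomial V k →ₐ[k] MvPolynomial W k).toRingHom =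
      varIdeal k (A.image f) := by
  rw [varIdeal, Ideal.map_span, Set.image_image, varIdeal, Finset.coe_image, Set.image_image]
  congr 1
  exact Set.image_congr fun w _ => rename_X f w

/-- With `g` choosing one preimage of each value of `f`, every `p` is congruent to `rename g (rename
f p)` modulo the differences. -/
theorem ker_rename {V W : Type*} (f : V → W) :
    RingHom.ker (rename f : MvPolynomial V k →ₐ[k] MvPolynomial W k) =
      Ideal.span {p | ∃ q q', f q = f q' ∧ p = (X q - X q' : MvPolynomial V k)} := by
  apply le_antisymm
  · rcases isEmpty_or_nonempty V with hV | hV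
    · intro p hp
      have hinj := rename_injective (R := k) f (Function.injective_of_subsingleton f)
      rw [hinj ((RingHom.mem_ker.1 hp).trans (map_zero _).symm)]
      exact Ideal.zero_mem _
    · let g := Function.invFun f
      have key : ∀ p : MvPolynomial V k, p - rename g (rename f p) ∈
          Ideal.span {p | ∃ q q', f q = f q' ∧ p = (X q - X q' : MvPolynomial V k)} := by
        intro p
        induction p using MvPolynomial.induction_on with
        | C a => simp
        | add p q hp hq =>
          rw [map_add, map_add, add_sub_add_comm]
          exact Ideal.add_mem _ hp hq
        | mul_X p w hp =>
          have : p * X w - rename g (rename f (p * X w)) =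
              (p - rename g (rename f p)) * X w + rename g (rename f p) * (X w - X (g (f w))) := by
            simp only [map_mul, rename_X]; ring
          rw [this]
          refine Ideal.add_mem _ (Ideal.mul_mem_right _ _ hp) (Ideal.mul_mem_left _ _ ?_)
          exact Ideal.subset_span ⟨w, g (f w), (Function.invFun_eq ⟨w, rfl⟩).symm, rfl⟩
      intro p hp
      have h := key p
      rwa [RingHom.mem_ker.1 hp, map_zero, sub_zero] at h
  · rw [Ideal.span_le]
    rintro _ ⟨q, q', h, rfl⟩
    rw [SetLike.mem_coe, RingHom.mem_ker, map_sub, rename_X, rename_X, h, sub_self]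

theorem ker_psi (ha : Monotone a) (hN : n + a (d - 1) ≤ N) :
    RingHom.ker (psi k n d N a) = Ideal.span (linForms k n d a) := by
  rw [psi_eq_rename k ha hN, ker_rename]
  simp only [shiftMap, Fin.mk.injEq]
  rfl

theorem span_eq_of_submodule_span_eq {R : Type*} [CommRing R] [Algebra k R] {s t : Set R}
    (h : Submodule.span k s = Submodule.span k t) : Ideal.span s = Ideal.span t := by
  have aux : ∀ {s t : Set R}, Submodule.span k s ≤ Submodule.span k t →
      Ideal.span s ≤ Ideal.span t := fun {s t} h =>
    Ideal.span_le.2 fun _ hx =>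
      Submodule.span_le_restrictScalars k R t (h (Submodule.subset_span hx))
  exact le_antisymm (aux h.le) (aux h.ge)

/-- A non-decreasing sequence of letters plus a strictly increasing shift is strictly increasing, so
no variable repeats. -/
theorem sigmaIdeal_isSquarefreeMonomialIdeal (ha : StrictMono a) (hN : n + a (d - 1) ≤ N)
    {I : Ideal (MvPolynomial (Fin n) k)} (hdeg : ∀ m ∈ minGens I, m.degree ≤ d) :
    IsSquarefreeMonomialIdeal (sigmaIdeal N a I) := by
  classical
  have key : ∀ m ∈ minGens I, ∃ F : Finset (Fin N),
      sigmaMonomial k N a m = ∏ w ∈ F, (X w : MvPolynomial (Fin N) k) := by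
    intro m hm
    have hp : ∀ p : Fin (alphaSeq m).length, ((alphaSeq m).get p).val + a p.val < N := fun p =>
      shift_lt (d := d) ha.monotone hN
        ((alphaSeq m).get p, ⟨p.val, p.2.trans_le (length_alphaSeq m ▸ hdeg m hm)⟩)
    have hstrict : StrictMono fun p : Fin (alphaSeq m).length =>
        (⟨((alphaSeq m).get p).val + a p.val, hp p⟩ : Fin N) := fun p q hpq =>
      Fin.lt_def.2 (add_lt_add_of_le_of_lt (Fin.le_def.1 (monotone_alphaSeq_get m hpq.le)) (ha hpq))
    refine ⟨Finset.univ.image fun p => ⟨_, hp p⟩, ?_⟩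
    rw [Finset.prod_image hstrict.injective.injOn, sigmaMonomial]
    exact Finset.prod_congr rfl fun p _ => by rw [varT, dif_pos (hp p)]
  refine ⟨{F | ∃ m ∈ minGens I, sigmaMonomial k N a m = ∏ w ∈ F, X w}, ?_⟩
  rw [sigmaIdeal]
  congr 1
  ext p
  constructor
  · rintro ⟨m, hm, rfl⟩
    obtain ⟨F, hF⟩ := key m hm
    exact ⟨F, ⟨m, hm, hF⟩, hF.symm⟩
  · rintro ⟨F, ⟨m, hm, hF⟩, rfl⟩
    exact ⟨m, hm, hF⟩

end Specialization

end BoxPol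

end

theorem proposition4p5 {k : Type*} [Field k] (n d N : ℕ) (hd : 0 < d)
    (a : ℕ → ℕ) (ha0 : a 0 = 0) (ha : Monotone a) (hN : n + a (d - 1) ≤ N)
    (I : Ideal (MvPolynomial (Fin n) k)) (hI : IsBorelFixed I)
    (hdeg : ∀ m ∈ minGens I, m.degree ≤ d) :
    -- the ideal generated by a basis of the span of `X_a` is the kernel of `ψ`
    (∀ Θ : Set (MvPolynomial (Fin n × Fin d) k), Θ ⊆ linForms k n d a →
      LinearIndepOn k id Θ → Submodule.span k Θ = Submodule.span k (linForms k n d a) →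
      RingHom.ker (psi k n d N a) = Ideal.span Θ) ∧
    -- pretty clean filtrations, the second one being the base change of the first one
    (∃ (t : ℕ)
      (F : Fin (t + 1) → Submodule (MvPolynomial (Fin n × Fin d) k)
        (MvPolynomial (Fin n × Fin d) k ⧸ boxIdeal d I))
      (P : Fin t → Ideal (MvPolynomial (Fin n × Fin d) k))
      (G : Fin (t + 1) → Submodule (MvPolynomial (Fin N) k)
        (MvPolynomial (Fin N) k ⧸ sigmaIdeal N a I))
      (Q : Fin t → Ideal (MvPolynomial (Fin N) k)),
      IsPrettyCleanFiltration F P ∧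
      IsPrettyCleanFiltration G Q ∧
      IsBaseChangeChain (psi k n d N a).toRingHom F G) ∧
    -- squarefreeness and shellability
    (StrictMono a → IsSquarefreeMonomialIdeal (sigmaIdeal N a I)) ∧
    (IsSquarefreeMonomialIdeal (sigmaIdeal N a I) →
      IsNonpureShellable (stanleyReisner (sigmaIdeal N a I))) := by
  have hL := hI.isSeqLowerSet (d := d)
  -- The heads depend only on `I`, `n` and `d`, so one enumeration serves both rings and matches the
  -- two filtrations step by step.
  obtain ⟨t, s, hinj, hrange, hkey⟩ :=
    exists_sorted_enumeration (heads_finite (n := n) (L := seqSet d I)) headKey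
  have hS := isVarColonSeq_seqExp hL isShiftMap_id hinj hrange hkey
  have hT := isVarColonSeq_seqExp hL (isShiftMap_shiftMap ha hN) hinj hrange hkey
  have hbox := hI.boxIdeal_eq hdeg
  have hmap := sigmaIdeal_eq_map N a hdeg
  have hpsi := psi_eq_rename k ha hN
  have hsigma : sigmaIdeal N a I =
      monoIdeal k (seqExp (shiftMap ha hN) n '' seqSet d I) := by
    rw [hmap, hbox, hpsi, map_rename_monoIdeal, Set.image_image]
    simp only [seqExp_mapDomain, Function.comp_id]
  have hsqf := fun h : StrictMono a => sigmaIdeal_isSquarefreeMonomialIdeal h hN hdeg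
  refine ⟨fun Θ _ _ hspan => ?_, ?_, hsqf, fun hsq => ?_⟩
  · rw [ker_psi ha hN, span_eq_of_submodule_span_eq hspan]
  · rw [hsigma, hbox] at hmap
    rw [hbox, hsigma]
    refine ⟨t, _, _, _, _, hS.isPrettyCleanFiltration, hT.isPrettyCleanFiltration, ?_⟩
    refine isBaseChangeChain_chainSubmodule _ hmap (fun i => ?_)
      (P := fun i => varIdeal k (insertSet id (s i)))
      (fun i r hr => (hS.mk_mem_iff i r).2 hr) (fun i b hb => ?_)
    · rw [hpsi]
      exact ((rename_monomial _ _ _).trans (by rw [seqExp_mapDomain, Function.comp_id])).symm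
    · rw [hpsi, map_rename_varIdeal, insertSet_comp, Function.comp_id]
      exact (hT.mk_mem_iff i b).1 hb
  · rw [hsigma] at hsq ⊢
    exact hT.isNonpureShellable hsq
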